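/- **Setting.** Let $Y_1,\dots,Y_d$ be a basis of $\mathbb{R}^d$, $\mathcal R$ the lattice that it generates, and $\mathcal V\subset\mathbb R^d$ a unit-cell, i.e. a set that tiles $\mathbb{R}^d$, up to null sets, by the translations of $\mathcal R$. Write $\langle f\rangle=\frac1{|\mathcal V|}\int_{\mathcal V}f\,dx$ and $s:e=\sum_{i,j}s_{ij}e_{ij}$. Let $L_0$ be a constant positive definite fourth-order tensor with major and minor symmetries, and let $L(x)$ be a field of such tensors that is measurable, essentially bounded and uniformly positive definite on $\mathcal V$. Let $H_e$ and $H_s$ both denote the space of $\mathcal R$-periodic symmetric second-order tensor fields in $L^2_{\mathrm{loc}}$, with the scalar products $\langle L_0\eta:\tilde\eta\rangle$ on $H_e$ and $\langle\tau:L_0^{-1}\tilde\tau\rangle$ on $H_s$. Let - $E_0\subset H_e$ be the set of fields $\frac12(\nabla w+\nabla w^{\top})$ with $w\in H^1_{\mathrm{per}}(\mathcal V)^d$ (that is, $w$ and its weak derivatives are $\mathcal R$-periodic and in $L^2_{\mathrm{loc}}$), and $E=U_e\oplus E_0$, where $U_e$ is the space of uniform fields in $H_e$; - $S_0\subset H_s$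 be the set of fields $s$ with $\langle s\rangle=0$, $\operatorname{div}s=0$ in $\mathcal V$ and $s\cdot n$ anti-periodic on $\partial\mathcal V$ (that is, the periodic field $s$ is divergence-free on $\mathbb R^d$ in the sense of distributions), and $S=U_s\oplus S_0$, where $U_s$ is the space of uniform fields in $H_s$. Let $P_{E_0}$ be the orthogonal projector of $H_e$ onto $E_0$ (which is closed) and $P_{S^\perp}$ the orthogonal projector of $H_s$ onto $S^\perp$. For a given symmetric tensor $\bar\varepsilon$ put $$r(x,\tau,\eta)=\tfrac12L(x)\eta:\eta+\tfrac12\tau:L(x)^{-1}\tau-\tau:\eta,$$ $$\mathcal P(\tau,\eta)=\tfrac12\|(I-P_{E_0})\eta-\bar\varepsilon\|_{H_e}^2+\langle r(x,\tau,\eta)\rangle+\tfrac12\|P_{S^\perp}\tau\|_{H_s}^2,\qquad(\tau,\eta)\in H_s\times H_e,$$ $$\mathcal J(e^*)=\tfrac12\langle L(\bar\varepsilon+e^*):(\bar\varepsilon+e^*)\rangle\ \ (e^*\in E_0),\qquad \mathcal J_c(s)=\tfrac12\langle s:L^{-1}s\rangle-\langle s\rangle:\bar\varepsilon\ \ (s\in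 S).$$ The gradient $\nabla\mathcal J(e^*)$ is the element of $E_0$ whose $H_e$-scalar product with each $h\in E_0$ is the derivative of $\mathcal J$ at $e^*$ in the direction $h$; likewise $\nabla\mathcal J_c(s)$ is the element of $S$ whose $H_s$-scalar product with each $h\in S$ is the derivative of $\mathcal J_c$ at $s$ in the direction $h$. **Proposition.** The space $E_0$ is closed in $H_e$. Let $e\in E$ with $\langle e\rangle=\bar\varepsilon$ and let $s\in S$. Then $e-\bar\varepsilon\in E_0$, the gradients $\nabla\mathcal J(e-\bar\varepsilon)$ and $\nabla\mathcal J_c(s)$ exist and are unique, and $$\mathcal P(s,e)=\langle r(x,s,e)\rangle,\qquad \mathcal P(Le,e)=\tfrac12\|\nabla\mathcal J(e-\bar\varepsilon)\|_{H_e}^2,\qquad \mathcal P(s,L^{-1}s)=\tfrac12\|\nabla\mathcal J_c(s)\|_{H_s}^2,$$ $$\mathcal P(Le,L^{-1}s)=\tfrac12\|\nabla\mathcal J_c(s)\|_{H_s}^2+\langle r(x,s,e)\rangle+\tfrac12\|\nabla\mathcal J(e-\bar\varepsilon)\|_{H_e}^2.$$ -/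

import Mathlib

open MeasureTheory Filter Topology
open scoped ContDiff

noncomputable section

namespace Composite

/-! ### Tensors -/

/-- The physical space `ℝ^d`. -/
abbrev Space (d : ℕ) : Type := EuclideanSpace ℝ (Fin d)

/-- Symmetric second-order tensors, with the doubly contracted product
`s : e = ∑ i j, s i j * e i j` as inner product. -/
def symTensor (d : ℕ) : Submodule ℝ (EuclideanSpace ℝ (Fin d × Fin d)) where
  carrier := {e | ∀ i j, e (i, j) = e (j, i)}
  add_mem' := by
    intro a b ha hb i j
    simp [ha i j, hb i j]
  zero_mem' := by
    intro i j
    simp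
  smul_mem' := by
    intro c a ha i j
    simp [ha i j]

/-- The type of symmetric second-order tensors. -/
abbrev SymTensor (d : ℕ) : Type := symTensor d

/-- The `(i, j)` component of a symmetric second-order tensor. -/
def SymTensor.comp {d : ℕ} (e : SymTensor d) (i j : Fin d) : ℝ :=
  (e : EuclideanSpace ℝ (Fin d × Fin d)) (i, j)

/-- The doubly contracted product `s : e`. -/
def ddot {d : ℕ} (s e : SymTensor d) : ℝ := ∑ i, ∑ j, s.comp i j * e.comp i j

theorem inner_eq_ddot {d : ℕ} (s e : SymTensor d) : inner ℝ s e = ddot s e := by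
  rw [Submodule.coe_inner, PiLp.inner_apply, Fintype.sum_prod_type]
  simp [ddot, SymTensor.comp, mul_comm]

/-- A positive definite fourth-order elasticity tensor.  A fourth-order tensor with the minor
symmetries is the same thing as a linear operator on symmetric second-order tensors, and the
major symmetry is the symmetry of this operator for the doubly contracted product. -/
structure ElasticityTensor (d : ℕ) where
  /-- the action `e ↦ L e` on symmetric second-order tensors -/
  op : SymTensor d →ₗ[ℝ] SymTensor d
  major_symm : ∀ e e' : SymTensor d, ddot (op e) e' = ddot e (op e')
  pos_def : ∀ e : SymTensor d, e ≠ 0 → 0 < ddot (op e) e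

namespace ElasticityTensor

variable {d : ℕ}

theorem injective (A : ElasticityTensor d) : Function.Injective A.op := by
  rw [← LinearMap.ker_eq_bot, LinearMap.ker_eq_bot']
  intro e he
  by_contra hne
  have h := A.pos_def e hne
  rw [he, ← inner_eq_ddot, inner_zero_left] at h
  exact lt_irrefl _ h

/-- The elasticity tensor as a linear automorphism of the symmetric second-order tensors. -/
def equiv (A : ElasticityTensor d) : SymTensor d ≃ₗ[ℝ] SymTensor d :=
  LinearEquiv.ofInjectiveEndo A.op A.injective

theorem equiv_apply (A : ElasticityTensor d) (e : SymTensor d) : A.equiv e = A.op e := rfl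

theorem op_equiv_symm (A : ElasticityTensor d) (e : SymTensor d) : A.op (A.equiv.symm e) = e := by
  rw [← equiv_apply, LinearEquiv.apply_symm_apply]

/-- The inverse (compliance) tensor `L⁻¹`. -/
def inv (A : ElasticityTensor d) : ElasticityTensor d where
  op := A.equiv.symm.toLinearMap
  major_symm := by
    intro e e'
    have h := A.major_symm (A.equiv.symm e) (A.equiv.symm e')
    rw [op_equiv_symm, op_equiv_symm] at h
    exact h.symm
  pos_def := by
    intro e he
    have h0 : A.equiv.symm e ≠ 0 := by simpa using he
    have h := A.pos_def _ h0
    rw [op_equiv_symm, ← inner_eq_ddot, real_inner_comm, inner_eq_ddot] at h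
    exact h

theorem op_inv (A : ElasticityTensor d) (e : SymTensor d) : A.op (A.inv.op e) = e :=
  A.op_equiv_symm e

end ElasticityTensor

/-- Symmetric second-order tensors with the energetic inner product `(e, e') ↦ A e : e'`. -/
def Energetic {d : ℕ} (_A : ElasticityTensor d) : Type := SymTensor d

namespace Energetic

variable {d : ℕ} (A : ElasticityTensor d)

instance : AddCommGroup (Energetic A) := inferInstanceAs (AddCommGroup (SymTensor d))

instance : Module ℝ (Energetic A) := inferInstanceAs (Module ℝ (SymTensor d))

instance : FiniteDimensional ℝ (Energetic A) :=
  inferInstanceAs (FiniteDimensional ℝ (SymTensor d))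

/-- The identity map, forgetting the energetic inner product. -/
def toSym : Energetic A ≃ₗ[ℝ] SymTensor d := LinearEquiv.refl ℝ (SymTensor d)

/-- The energetic inner product. -/
@[reducible]
def core : InnerProductSpace.Core ℝ (Energetic A) where
  inner e e' := ddot (A.op (toSym A e)) (toSym A e')
  conj_inner_symm e e' := by
    simp only [conj_trivial]
    rw [A.major_symm, ← inner_eq_ddot, real_inner_comm, inner_eq_ddot]
  re_inner_nonneg e := by
    rcases eq_or_ne (toSym A e) 0 with h | h
    · simp [h, ← inner_eq_ddot]
    · exact (A.pos_def _ h).le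
  add_left e e' f := by simp [← inner_eq_ddot, inner_add_left]
  smul_left e e' r := by simp [← inner_eq_ddot, real_inner_smul_left]
  definite e h := by
    by_contra hne
    have hne' : toSym A e ≠ 0 := by simpa using hne
    exact (A.pos_def _ hne').ne' h

instance : NormedAddCommGroup (Energetic A) := (core A).toNormedAddCommGroup

instance : InnerProductSpace ℝ (Energetic A) := InnerProductSpace.ofCore (core A).toCore

instance : CompleteSpace (Energetic A) := FiniteDimensional.complete ℝ _

theorem inner_def (e e' : Energetic A) :
    inner ℝ e e' = ddot (A.op (toSym A e)) (toSym A e') := rfl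

/-- The identity map as a homeomorphism. -/
def toSymL : Energetic A ≃L[ℝ] SymTensor d := (toSym A).toContinuousLinearEquiv

end Energetic

/-! ### The unit-cell and periodic functions -/

/-- A unit-cell: a set `V` that fills `ℝ^d`, up to null sets, by translation along the lattice
generated by the `d` vectors of a basis. -/
structure UnitCell (d : ℕ) where
  /-- the vectors that generate the lattice -/
  Y : Module.Basis (Fin d) ℝ (Space d)
  /-- the cell -/
  V : Set (Space d)
  isFundamental : IsAddFundamentalDomain (Submodule.span ℤ (Set.range Y)) V volume

namespace UnitCell

variable {d : ℕ} (Q : UnitCell d)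

/-- The lattice of periods. -/
def lattice : Submodule ℤ (Space d) := Submodule.span ℤ (Set.range Q.Y)

/-- The normalized measure on the cell: `∫ f ∂Q.avg` is the average of `f` over `V`. -/
def avg : Measure (Space d) := (volume Q.V)⁻¹ • volume.restrict Q.V

theorem volume_eq : volume Q.V = volume (ZSpan.fundamentalDomain Q.Y) := by
  have : VAddInvariantMeasure (Submodule.span ℤ (Set.range Q.Y)) (Space d) volume :=
    inferInstanceAs <| VAddInvariantMeasure
      (Submodule.span ℤ (Set.range Q.Y)).toAddSubgroup (Space d) volume
  have : Countable (Submodule.span ℤ (Set.range Q.Y)) :=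
    inferInstanceAs <| Countable (Submodule.span ℤ (Set.range Q.Y))
  exact Q.isFundamental.measure_eq (ZSpan.isAddFundamentalDomain Q.Y volume)

theorem volume_ne_zero : volume Q.V ≠ 0 := by
  rw [volume_eq]
  exact ZSpan.measure_fundamentalDomain_ne_zero Q.Y

theorem volume_ne_top : volume Q.V ≠ ⊤ := by
  rw [volume_eq]
  exact (ZSpan.fundamentalDomain_isBounded Q.Y).measure_lt_top.ne

instance : IsProbabilityMeasure Q.avg where
  measure_univ := by
    rw [avg, Measure.smul_apply, Measure.restrict_apply_univ, smul_eq_mul,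
      ENNReal.inv_mul_cancel Q.volume_ne_zero Q.volume_ne_top]

/-- `f` belongs to `L²_per`: it is locally square integrable on `ℝ^d` and periodic with respect
to the lattice. -/
structure IsL2Per (f : Space d → ℝ) : Prop where
  periodic : ∀ Y ∈ Q.lattice, ∀ᵐ x, f (x + Y) = f x
  local_memLp : ∀ K : Set (Space d), IsCompact K → MemLp f 2 (volume.restrict K)

end UnitCell

/-- Test functions on `ℝ^d`: smooth with compact support. -/
structure IsTest {d : ℕ} (φ : Space d → ℝ) : Prop where
  smooth : ContDiff ℝ ∞ φ
  compact : HasCompactSupport φ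

/-- The classical partial derivative `∂φ/∂x_j` of a smooth function. -/
def pderiv {d : ℕ} (j : Fin d) (φ : Space d → ℝ) (x : Space d) : ℝ :=
  fderiv ℝ φ x (EuclideanSpace.single j 1)

/-- `g` is the partial derivative `∂f/∂x_j` in the sense of distributions on `ℝ^d`. -/
def IsWeakPartial {d : ℕ} (j : Fin d) (f g : Space d → ℝ) : Prop :=
  ∀ φ : Space d → ℝ, IsTest φ → ∫ x, f x * pderiv j φ x = -∫ x, g x * φ x

/-- The tensor field with components `t i j` is divergence-free in the sense of distributions on
`ℝ^d`.  For a periodic field this contains, besides `div t = 0` in the cell, the anti-periodicity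
of the traction `t · n` on its boundary, i.e. the absence of jumps of `t · n` across the cell
faces. -/
def IsWeakDivFree {d : ℕ} (t : Fin d → Fin d → Space d → ℝ) : Prop :=
  ∀ φ : Space d → ℝ, IsTest φ → ∀ i, ∑ j, ∫ x, t i j x * pderiv j φ x = 0

theorem UnitCell.IsL2Per.zero {d : ℕ} (Q : UnitCell d) : Q.IsL2Per (fun _ => 0) :=
  ⟨fun _ _ => by simp, fun _ _ => MemLp.zero'⟩

theorem UnitCell.IsL2Per.add {d : ℕ} {Q : UnitCell d} {f g : Space d → ℝ} (hf : Q.IsL2Per f)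
    (hg : Q.IsL2Per g) : Q.IsL2Per (fun x => f x + g x) := by
  refine ⟨fun Y hY => ?_, fun K hK => (hf.local_memLp K hK).add (hg.local_memLp K hK)⟩
  filter_upwards [hf.periodic Y hY, hg.periodic Y hY] with x h1 h2
  rw [h1, h2]

theorem UnitCell.IsL2Per.smul {d : ℕ} {Q : UnitCell d} {f : Space d → ℝ} (c : ℝ)
    (hf : Q.IsL2Per f) : Q.IsL2Per (fun x => c * f x) := by
  refine ⟨fun Y hY => ?_, fun K hK => (hf.local_memLp K hK).const_mul c⟩
  filter_upwards [hf.periodic Y hY] with x h1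
  rw [h1]

theorem UnitCell.IsL2Per.integrable_mul {d : ℕ} {Q : UnitCell d} {f φ : Space d → ℝ}
    (hf : Q.IsL2Per f) (hφ : Continuous φ) (hc : HasCompactSupport φ) :
    Integrable (fun x => f x * φ x) := by
  have hl : LocallyIntegrable f := by
    rw [locallyIntegrable_iff]
    intro K hK
    have : IsFiniteMeasure (volume.restrict K) := ⟨by simpa using hK.measure_lt_top⟩
    exact (hf.local_memLp K hK).integrable (by norm_num)
  exact hl.integrable_smul_right_of_hasCompactSupport hφ hc

theorem IsTest.continuous_pderiv {d : ℕ} {φ : Space d → ℝ} (h : IsTest φ) (j : Fin d) :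
    Continuous (pderiv j φ) :=
  (h.smooth.continuous_fderiv (by simp)).clm_apply continuous_const

theorem IsTest.hasCompactSupport_pderiv {d : ℕ} {φ : Space d → ℝ} (h : IsTest φ) (j : Fin d) :
    HasCompactSupport (pderiv j φ) :=
  (h.compact.fderiv (𝕜 := ℝ)).comp_left (g := fun T : Space d →L[ℝ] ℝ =>
    T (EuclideanSpace.single j 1)) (by simp)

/-! ### Tensor fields -/

variable {d : ℕ}

/-- The Hilbert space of periodic square integrable symmetric tensor fields, described by their
restriction to the cell, with the energetic scalar product `⟨A η : η'⟩`. -/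
abbrev Field (Q : UnitCell d) (A : ElasticityTensor d) : Type := Lp (Energetic A) 2 Q.avg

/-- The space `H_e` of strain fields, with the scalar product `⟨L₀ η : η'⟩`. -/
abbrev StrainField (Q : UnitCell d) (L₀ : ElasticityTensor d) : Type := Field Q L₀

/-- The space `H_s` of stress fields, with the scalar product `⟨τ : L₀⁻¹ τ'⟩`. -/
abbrev StressField (Q : UnitCell d) (L₀ : ElasticityTensor d) : Type := Field Q L₀.inv

variable {Q : UnitCell d} {A : ElasticityTensor d}

/-- The value at `x` of (a representative of) a tensor field. -/
def val (η : Field Q A) (x : Space d) : SymTensor d := Energetic.toSym A (η x)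

/-- The average `⟨η⟩` of a tensor field over the cell. -/
def mean (η : Field Q A) : SymTensor d := ∫ x, val η x ∂Q.avg

/-- The duality product `⟨τ : η⟩`. -/
def dual {B : ElasticityTensor d} (τ : Field Q A) (η : Field Q B) : ℝ :=
  ∫ x, ddot (val τ x) (val η x) ∂Q.avg

theorem inner_eq_average (η η' : Field Q A) :
    inner ℝ η η' = ∫ x, ddot (A.op (val η x)) (val η' x) ∂Q.avg := rfl

/-- The uniform tensor field with value `ε`. -/
def uniform (Q : UnitCell d) (A : ElasticityTensor d) (ε : SymTensor d) : Field Q A :=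
  Lp.const 2 Q.avg ((Energetic.toSym A).symm ε)

theorem val_add (η η' : Field Q A) : ∀ᵐ x ∂Q.avg, val (η + η') x = val η x + val η' x := by
  filter_upwards [Lp.coeFn_add η η'] with x hx
  rw [val, hx, Pi.add_apply, map_add]
  rfl

theorem val_smul (c : ℝ) (η : Field Q A) : ∀ᵐ x ∂Q.avg, val (c • η) x = c • val η x := by
  filter_upwards [Lp.coeFn_smul c η] with x hx
  rw [val, hx, Pi.smul_apply, map_smul]
  rfl

theorem val_zero : ∀ᵐ x ∂Q.avg, val (0 : Field Q A) x = 0 := by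
  filter_upwards [Lp.coeFn_zero (Energetic A) 2 Q.avg] with x hx
  rw [val, hx, Pi.zero_apply, map_zero]

theorem val_uniform (ε : SymTensor d) : ∀ᵐ x ∂Q.avg, val (uniform Q A ε) x = ε := by
  filter_upwards [Lp.coeFn_const (p := 2) (μ := Q.avg) ((Energetic.toSym A).symm ε)] with x hx
  rw [val, uniform, hx]
  simp

theorem integrable_val (η : Field Q A) : Integrable (val η) Q.avg :=
  (Energetic.toSymL A).toContinuousLinearMap.integrable_comp
    ((Lp.memLp η).integrable (by norm_num))

/-- The subspace `U` of uniform fields. -/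
def uniformFields (Q : UnitCell d) (A : ElasticityTensor d) : Submodule ℝ (Field Q A) where
  carrier := Set.range (uniform Q A)
  add_mem' := by
    rintro _ _ ⟨a, rfl⟩ ⟨b, rfl⟩
    exact ⟨a + b, by simp [uniform]⟩
  zero_mem' := ⟨0, by simp [uniform]⟩
  smul_mem' := by
    rintro c _ ⟨a, rfl⟩
    refine ⟨c • a, ?_⟩
    apply Lp.ext
    filter_upwards [Lp.coeFn_const (p := 2) (μ := Q.avg) ((Energetic.toSym A).symm a),
      Lp.coeFn_const (p := 2) (μ := Q.avg) ((Energetic.toSym A).symm (c • a)),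
      Lp.coeFn_smul c (Lp.const 2 Q.avg ((Energetic.toSym A).symm a))] with x h1 h2 h3
    simp only [uniform]
    rw [h2, h3, Pi.smul_apply, h1]
    simp

/-- The space `E₀` of compatible strain fields: the symmetrized gradients
`(∇w + ∇wᵀ) / 2` of the periodic displacements `w` whose components belong to `H¹_per`, i.e. are
in `L²_per` with all weak partial derivatives `∂w_i/∂x_j = G i j` in `L²_per`. -/
def compatible (Q : UnitCell d) (L₀ : ElasticityTensor d) :
    Submodule ℝ (StrainField Q L₀) where
  carrier := {e | ∃ (w : Fin d → Space d → ℝ) (G : Fin d → Fin d → Space d → ℝ),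
    (∀ i, Q.IsL2Per (w i)) ∧ (∀ i j, Q.IsL2Per (G i j)) ∧
    (∀ i j, IsWeakPartial j (w i) (G i j)) ∧
    ∀ᵐ x ∂Q.avg, ∀ i j, (val e x).comp i j = (1 / 2) * (G i j x + G j i x)}
  add_mem' := by
    rintro a b ⟨w, G, hw, hG, hd, he⟩ ⟨w', G', hw', hG', hd', he'⟩
    refine ⟨fun i x => w i x + w' i x, fun i j x => G i j x + G' i j x,
      fun i => (hw i).add (hw' i), fun i j => (hG i j).add (hG' i j), ?_, ?_⟩
    · intro i j φ hφ
      simp only [add_mul]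
      rw [integral_add ((hw i).integrable_mul (hφ.continuous_pderiv j)
          (hφ.hasCompactSupport_pderiv j)) ((hw' i).integrable_mul (hφ.continuous_pderiv j)
          (hφ.hasCompactSupport_pderiv j)),
        integral_add ((hG i j).integrable_mul hφ.smooth.continuous hφ.compact)
          ((hG' i j).integrable_mul hφ.smooth.continuous hφ.compact), hd i j φ hφ, hd' i j φ hφ]
      ring
    · filter_upwards [he, he', val_add a b] with x h1 h2 h3 i j
      have : (val (a + b) x).comp i j = (val a x).comp i j + (val b x).comp i j := by
        rw [h3]; rfl
      rw [this, h1, h2]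
      ring
  zero_mem' := by
    refine ⟨fun _ _ => 0, fun _ _ _ => 0, fun _ => .zero Q, fun _ _ => .zero Q, ?_, ?_⟩
    · intro i j φ _
      simp
    · filter_upwards [val_zero (Q := Q) (A := L₀)] with x h i j
      rw [h]
      simp [SymTensor.comp]
  smul_mem' := by
    rintro c a ⟨w, G, hw, hG, hd, he⟩
    refine ⟨fun i x => c * w i x, fun i j x => c * G i j x,
      fun i => (hw i).smul c, fun i j => (hG i j).smul c, ?_, ?_⟩
    · intro i j φ hφ
      simp only [mul_assoc, integral_const_mul]
      rw [hd i j φ hφ]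
      ring
    · filter_upwards [he, val_smul c a] with x h1 h3 i j
      have : (val (c • a) x).comp i j = c * (val a x).comp i j := by
        rw [h3]; rfl
      rw [this, h1]
      ring

/-- The space `E = U_e ⊕ E₀` of kinematically admissible strain fields. -/
def admissibleStrains (Q : UnitCell d) (L₀ : ElasticityTensor d) :
    Submodule ℝ (StrainField Q L₀) :=
  uniformFields Q L₀ ⊔ compatible Q L₀

/-- The space `S₀` of self-equilibrated stress fields: the periodic extension `t` of the field is
divergence-free on `ℝ^d`, and the field has zero average. -/
def selfEquilibrated (Q : UnitCell d) (L₀ : ElasticityTensor d) :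
    Submodule ℝ (StressField Q L₀) where
  carrier := {s | (∃ t : Fin d → Fin d → Space d → ℝ,
      (∀ i j, Q.IsL2Per (t i j)) ∧ IsWeakDivFree t ∧
      ∀ᵐ x ∂Q.avg, ∀ i j, (val s x).comp i j = t i j x) ∧
    mean s = 0}
  add_mem' := by
    rintro a b ⟨⟨t, ht, hd, he⟩, hm⟩ ⟨⟨t', ht', hd', he'⟩, hm'⟩
    refine ⟨⟨fun i j x => t i j x + t' i j x, fun i j => (ht i j).add (ht' i j), ?_, ?_⟩, ?_⟩
    · intro φ hφ i
      have h : ∀ j, ∫ x, (t i j x + t' i j x) * pderiv j φ x =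
          (∫ x, t i j x * pderiv j φ x) + ∫ x, t' i j x * pderiv j φ x := by
        intro j
        simp only [add_mul]
        exact integral_add ((ht i j).integrable_mul (hφ.continuous_pderiv j)
          (hφ.hasCompactSupport_pderiv j)) ((ht' i j).integrable_mul (hφ.continuous_pderiv j)
          (hφ.hasCompactSupport_pderiv j))
      simp only [h, Finset.sum_add_distrib]
      rw [hd φ hφ i, hd' φ hφ i, add_zero]
    · filter_upwards [he, he', val_add a b] with x h1 h2 h3 i j
      have : (val (a + b) x).comp i j = (val a x).comp i j + (val b x).comp i j := by
        rw [h3]; rfl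
      rw [this, h1, h2]
    · rw [mean, integral_congr_ae (val_add a b),
        integral_add (integrable_val a) (integrable_val b)]
      change mean a + mean b = 0
      rw [hm, hm', add_zero]
  zero_mem' := by
    refine ⟨⟨fun _ _ _ => 0, fun _ _ => .zero Q, ?_, ?_⟩, ?_⟩
    · intro φ _ i
      simp
    · filter_upwards [val_zero (Q := Q) (A := L₀.inv)] with x h i j
      rw [h]
      simp [SymTensor.comp]
    · rw [mean, integral_congr_ae val_zero, integral_zero]
  smul_mem' := by
    rintro c a ⟨⟨t, ht, hd, he⟩, hm⟩
    refine ⟨⟨fun i j x => c * t i j x, fun i j => (ht i j).smul c, ?_, ?_⟩, ?_⟩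
    · intro φ hφ i
      simp only [mul_assoc, integral_const_mul, ← Finset.mul_sum]
      rw [hd φ hφ i, mul_zero]
    · filter_upwards [he, val_smul c a] with x h1 h3 i j
      have : (val (c • a) x).comp i j = c * (val a x).comp i j := by
        rw [h3]; rfl
      rw [this, h1]
    · rw [mean, integral_congr_ae (val_smul c a), integral_smul]
      change c • mean a = 0
      rw [hm, smul_zero]

/-- The space `S = U_s ⊕ S₀` of statically admissible stress fields. -/
def admissibleStresses (Q : UnitCell d) (L₀ : ElasticityTensor d) :
    Submodule ℝ (StressField Q L₀) :=
  uniformFields Q L₀.inv ⊔ selfEquilibrated Q L₀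

/-- The orthogonal projector of `H_e` onto `E₀`.  It is written as the projector onto the closure
of `E₀`, which makes sense before `E₀` is known to be closed. -/
def projCompatible (Q : UnitCell d) (L₀ : ElasticityTensor d) :
    StrainField Q L₀ →L[ℝ] StrainField Q L₀ :=
  (compatible Q L₀).topologicalClosure.starProjection

/-- The orthogonal projector of `H_s` onto the orthogonal complement of `S`. -/
def projStressOrth (Q : UnitCell d) (L₀ : ElasticityTensor d) :
    StressField Q L₀ →L[ℝ] StressField Q L₀ :=
  (admissibleStresses Q L₀)ᗮ.starProjection

/-! ### The elasticity tensor of the composite -/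

/-- The elasticity tensor field of the composite: measurable, bounded and uniformly positive
definite on the cell. -/
structure StiffnessField (Q : UnitCell d) where
  /-- the local elasticity tensor -/
  tensor : Space d → ElasticityTensor d
  measurable : ∀ e, AEStronglyMeasurable (fun x => (tensor x).op e) Q.avg
  bounded : ∃ M : ℝ, ∀ᵐ x ∂Q.avg, ∀ e, ‖(tensor x).op e‖ ≤ M * ‖e‖
  coercive : ∃ α : ℝ, 0 < α ∧ ∀ᵐ x ∂Q.avg, ∀ e, α * ‖e‖ ^ 2 ≤ ddot ((tensor x).op e) e

namespace StiffnessField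

/-- The local operators, as continuous linear maps. -/
def clm (L : StiffnessField Q) (x : Space d) : SymTensor d →L[ℝ] SymTensor d :=
  (L.tensor x).op.toContinuousLinearMap

theorem measurable_clm (L : StiffnessField Q) : AEStronglyMeasurable L.clm Q.avg := by
  let b := Module.finBasis ℝ (SymTensor d)
  have h : L.clm = fun x => ∑ i, (b.coord i).toContinuousLinearMap.smulRight
      ((L.tensor x).op (b i)) := by
    funext x
    ext1 e
    rw [FunLike.coe_sum, Finset.sum_apply]
    change (L.tensor x).op e = ∑ i, b.repr e i • (L.tensor x).op (b i)
    conv_lhs => rw [← b.sum_repr e]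
    rw [map_sum]
    simp only [map_smul]
  rw [h]
  refine Finset.aestronglyMeasurable_fun_sum _ fun i _ => ?_
  exact (ContinuousLinearMap.smulRightL ℝ (SymTensor d) (SymTensor d)
    (b.coord i).toContinuousLinearMap).continuous.comp_aestronglyMeasurable (L.measurable (b i))

theorem measurable_ring_inverse (F : Type) [NormedAddCommGroup F] [InnerProductSpace ℝ F]
    [FiniteDimensional ℝ F] {f : Space d → F →L[ℝ] F} {μ : Measure (Space d)}
    (hf : AEStronglyMeasurable f μ) :
    AEStronglyMeasurable (fun x => Ring.inverse (f x)) μ := by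
  classical
  have : CompleteSpace F := FiniteDimensional.complete ℝ F
  have hm : Measurable (Ring.inverse : (F →L[ℝ] F) → (F →L[ℝ] F)) := by
    have hc : ContinuousOn (Ring.inverse : (F →L[ℝ] F) → (F →L[ℝ] F)) {T | IsUnit T} := by
      rintro _ ⟨u, rfl⟩
      exact (NormedRing.inverse_continuousAt u).continuousWithinAt
    have h := hc.measurable_piecewise (g := fun _ => (0 : F →L[ℝ] F)) continuousOn_const
      (Units.isOpen (R := F →L[ℝ] F)).measurableSet
    convert h using 1
    funext T
    by_cases hT : IsUnit T
    · simp [Set.piecewise, hT]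
    · simp [Set.piecewise, hT, Ring.inverse_non_unit]
  have : FiniteDimensional ℝ (F →L[ℝ] F) := inferInstance
  have : ProperSpace (F →L[ℝ] F) := FiniteDimensional.proper ℝ _
  exact (hm.comp_aemeasurable hf.aemeasurable).aestronglyMeasurable

theorem inv_eq (L : StiffnessField Q) (x : Space d) (e : SymTensor d) :
    (L.tensor x).inv.op e = Ring.inverse (L.clm x) e := by
  let T : SymTensor d →L[ℝ] SymTensor d := (L.tensor x).inv.op.toContinuousLinearMap
  have h1 : L.clm x * T = 1 := by
    ext1 v
    exact (L.tensor x).op_inv v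
  have h2 : T * L.clm x = 1 := by
    ext1 v
    exact (L.tensor x).equiv.symm_apply_apply v
  have h := Ring.inverse_unit (⟨L.clm x, T, h1, h2⟩ : (SymTensor d →L[ℝ] SymTensor d)ˣ)
  change Ring.inverse (L.clm x) = T at h
  rw [h]
  rfl

theorem norm_inv_le {B : ElasticityTensor d} {α : ℝ} (hα : 0 < α)
    (h : ∀ e, α * ‖e‖ ^ 2 ≤ ddot (B.op e) e) (s : SymTensor d) :
    ‖B.inv.op s‖ ≤ α⁻¹ * ‖s‖ := by
  have h1 := h (B.inv.op s)
  rw [B.op_inv, ← inner_eq_ddot] at h1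
  have h2 := h1.trans (real_inner_le_norm s (B.inv.op s))
  rw [inv_mul_eq_div, le_div_iff₀ hα]
  rcases (norm_nonneg (B.inv.op s)).eq_or_lt with h0 | h0
  · rw [← h0, zero_mul]
    exact norm_nonneg s
  · nlinarith

/-- The field of compliance tensors `x ↦ L(x)⁻¹`. -/
def inv (L : StiffnessField Q) : StiffnessField Q where
  tensor x := (L.tensor x).inv
  measurable e := by
    simp only [inv_eq]
    exact (measurable_ring_inverse _ L.measurable_clm).apply_continuousLinearMap e
  bounded := by
    obtain ⟨α, hα, h⟩ := L.coercive
    refine ⟨α⁻¹, ?_⟩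
    filter_upwards [h] with x hx e
    exact norm_inv_le hα hx e
  coercive := by
    obtain ⟨α, hα, h⟩ := L.coercive
    obtain ⟨M, hM⟩ := L.bounded
    have hM1 : 0 < |M| + 1 := by positivity
    refine ⟨α / (|M| + 1) ^ 2, by positivity, ?_⟩
    filter_upwards [h, hM] with x hx hMx e
    have h1 := hx ((L.tensor x).inv.op e)
    have h2 := hMx ((L.tensor x).inv.op e)
    rw [ElasticityTensor.op_inv] at h1 h2
    rw [← inner_eq_ddot, real_inner_comm, inner_eq_ddot] at h1
    have h3 : ‖e‖ ≤ (|M| + 1) * ‖(L.tensor x).inv.op e‖ :=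
      h2.trans (mul_le_mul_of_nonneg_right (by linarith [le_abs_self M]) (norm_nonneg _))
    have h4 : ‖e‖ ^ 2 ≤ (|M| + 1) ^ 2 * ‖(L.tensor x).inv.op e‖ ^ 2 := by
      rw [← mul_pow]
      exact pow_le_pow_left₀ (norm_nonneg _) h3 2
    refine le_trans ?_ h1
    rw [div_mul_eq_mul_div, div_le_iff₀ (by positivity)]
    nlinarith

theorem memLp (L : StiffnessField Q) (B : ElasticityTensor d) (η : Field Q A) :
    MemLp (fun x => (Energetic.toSym B).symm ((L.tensor x).op (val η x))) 2 Q.avg := by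
  have hη : MemLp (val η) 2 Q.avg :=
    (Energetic.toSymL A).toContinuousLinearMap.comp_memLp' (Lp.memLp η)
  have hL : MemLp (fun x => (L.tensor x).op (val η x)) 2 Q.avg := by
    obtain ⟨M, hM⟩ := L.bounded
    refine hη.of_le_mul (c := M) ?_ ?_
    · exact (isBoundedBilinearMap_apply (𝕜 := ℝ) (E := SymTensor d)
        (F := SymTensor d)).continuous.comp_aestronglyMeasurable (L.measurable_clm.prodMk hη.1)
    · filter_upwards [hM] with x hx
      exact hx _
  exact (Energetic.toSymL B).symm.toContinuousLinearMap.comp_memLp' hL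

/-- The field `x ↦ L(x) η(x)`, as an element of the space of fields with energy tensor `B`. -/
def mul (L : StiffnessField Q) (B : ElasticityTensor d) (η : Field Q A) : Field Q B :=
  (L.memLp B η).toLp _

theorem val_mul (L : StiffnessField Q) (B : ElasticityTensor d) (η : Field Q A) :
    ∀ᵐ x ∂Q.avg, val (L.mul B η) x = (L.tensor x).op (val η x) := by
  filter_upwards [(L.memLp B η).coeFn_toLp] with x hx
  rw [val, mul, hx]
  simp

end StiffnessField

variable {L₀ : ElasticityTensor d}

/-- The stress field `L η` associated with a strain field `η`. -/
def stressOf (L : StiffnessField Q) (η : StrainField Q L₀) : StressField Q L₀ :=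
  L.mul L₀.inv η

/-- The strain field `L⁻¹ τ` associated with a stress field `τ`. -/
def strainOf (L : StiffnessField Q) (τ : StressField Q L₀) : StrainField Q L₀ :=
  L.inv.mul L₀ τ

/-! ### The functionals -/

/-- The local error in constitutive relations
`r(x, τ, η) = 1/2 L(x)η : η + 1/2 τ : L(x)⁻¹τ - τ : η`. -/
def constError (L : StiffnessField Q) (x : Space d) (τ η : SymTensor d) : ℝ :=
  (1 / 2) * ddot ((L.tensor x).op η) η + (1 / 2) * ddot τ ((L.tensor x).inv.op τ) - ddot τ η

/-- The mean error in constitutive relations `⟨r(x, τ, η)⟩`. -/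
def meanConstError (L : StiffnessField Q) (τ : StressField Q L₀) (η : StrainField Q L₀) : ℝ :=
  ∫ x, constError L x (val τ x) (val η x) ∂Q.avg

/-- The error in kinematic admissibility `1/2 ‖(I - P_{E₀}) η - ε‖²` for the prescribed average
strain `ε`. -/
def compatError (ε : SymTensor d) (η : StrainField Q L₀) : ℝ :=
  (1 / 2) * ‖(η - projCompatible Q L₀ η) - uniform Q L₀ ε‖ ^ 2

/-- The error in static admissibility `1/2 ‖P_{S^⊥} τ‖²`. -/
def equilError (τ : StressField Q L₀) : ℝ :=
  (1 / 2) * ‖projStressOrth Q L₀ τ‖ ^ 2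

/-- The two-field geometric functional `P(τ, η)`. -/
def geomFunctional (L : StiffnessField Q) (ε : SymTensor d) (τ : StressField Q L₀)
    (η : StrainField Q L₀) : ℝ :=
  compatError ε η + meanConstError L τ η + equilError τ

/-- The strain energy `J(e*) = 1/2 ⟨L (ε + e*) : (ε + e*)⟩`. -/
def strainEnergy (L : StiffnessField Q) (ε : SymTensor d) (e : StrainField Q L₀) : ℝ :=
  (1 / 2) * dual (stressOf L (uniform Q L₀ ε + e)) (uniform Q L₀ ε + e)

/-- The complementary energy `J_c(s) = 1/2 ⟨s : L⁻¹ s⟩ - ⟨s⟩ : ε`. -/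
def complEnergy (L : StiffnessField Q) (ε : SymTensor d) (s : StressField Q L₀) : ℝ :=
  (1 / 2) * dual s (strainOf L s) - ddot (mean s) ε

/-- `g` is the gradient at `x ∈ K` of the restriction of `F` to the subspace `K`: the element of
`K` such that `⟪g, h⟫` is the derivative of `F` at `x` in every direction `h ∈ K`. -/
def IsGradientOn {H : Type*} [NormedAddCommGroup H] [InnerProductSpace ℝ H] (K : Submodule ℝ H)
    (F : H → ℝ) (x g : H) : Prop :=
  x ∈ K ∧ g ∈ K ∧
    ∀ h ∈ K, Tendsto (fun t : ℝ => (F (x + t • h) - F x) / t) (𝓝[≠] 0) (𝓝 (inner ℝ g h))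

end Composite

end

open MeasureTheory Filter Topology
open scoped ContDiff
noncomputable section

namespace Composite

variable {d : ℕ}

/-! The whole argument rests on one fact: `S` is exactly the annihilator of `E₀` for the duality
product `⟨s : e⟩` (`mem_admissibleStresses_iff`). The map `η ↦ L₀ η` is an isometry of `H_e` onto
`H_s` that turns this product into a scalar product, so `S^⊥ = L₀ E₀` as soon as `E₀` is closed.

The derivative of `J` at `e - ε` is `h ↦ ⟨Le : h⟩` on `E₀`. Its gradient `g` therefore makes `Le -
L₀ g` annihilate `E₀`, that is, lie in `S`, while `L₀ g` lies in `S^⊥`. Hence `P_{S^⊥}(Le) = L₀ g`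
(`equilError_stressOf`). Dually, if `g` is the gradient of `J_c` at `s`, then `(I - P_{E₀})(L⁻¹s) -
ε = L₀⁻¹ g` (`compatError_strainOf`). Admissible fields have no admissibility error. The
constitutive error vanishes on the pairs `(Le, e)` and `(s, L⁻¹s)`, and it is the same for `(Le,
L⁻¹s)` as for `(s, e)` because `⟨Le : L⁻¹s⟩ = ⟨s : e⟩`. The four identities follow.

The analysis is done with Fourier series. Integrals over `ℝ^d` against test functions unfold to
integrals over the cell against periodized functions, so weak derivatives become relations between
Fourier coefficients. The plane waves are complete, since trigonometric polynomials are dense in the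
continuous functions on the torus. Parseval's identity then gives Korn's and Poincaré's
inequalities, hence the closedness of `E₀` (`isClosed_range_symGrad`), and it gives the
orthogonality of `S₀` and `E₀` frequency by frequency. -/

namespace UnitCell

/-! ### Periodization over the lattice. -/

instance (Q : UnitCell d) : Countable Q.lattice :=
  inferInstanceAs <| Countable (Submodule.span ℤ (Set.range Q.Y))

instance (Q : UnitCell d) : VAddInvariantMeasure Q.lattice (Space d) volume :=
  inferInstanceAs <| VAddInvariantMeasure
    (Submodule.span ℤ (Set.range Q.Y)).toAddSubgroup (Space d) volume

theorem isFundamental' (Q : UnitCell d) : IsAddFundamentalDomain Q.lattice Q.V volume :=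
  Q.isFundamental

/-- The periodization of a function with respect to the lattice of the unit-cell. -/
def periodize (Q : UnitCell d) (φ : Space d → ℝ) (x : Space d) : ℝ :=
  ∑' Y : Q.lattice, φ (Y + x)

/-- A lattice meets a ball in finitely many points. One finite set serves a whole neighbourhood, so
the periodization is locally a finite sum and inherits smoothness. -/
theorem exists_finset_translates (Q : UnitCell d) {φ : Space d → ℝ} (hφ : HasCompactSupport φ)
    (x₀ : Space d) :
    ∃ F : Finset Q.lattice, ∀ x ∈ Metric.ball x₀ 1, ∀ Y ∉ F, φ (Y + x) = 0 := by
  obtain ⟨R, hR⟩ := hφ.isBounded.subset_closedBall (0 : Space d)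
  have hfin : {Y : Q.lattice | ‖(Y : Space d)‖ ≤ R + ‖x₀‖ + 1}.Finite := by
    have h := ZSpan.setFinite_inter Q.Y
      (Metric.isBounded_closedBall (x := (0 : Space d)) (r := R + ‖x₀‖ + 1))
    refine (h.preimage (f := ((↑) : Q.lattice → Space d)) Subtype.val_injective.injOn).subset ?_
    intro Y hY
    exact ⟨by simpa using hY, Y.2⟩
  refine ⟨hfin.toFinset, fun x hx Y hY => ?_⟩
  by_contra hne
  refine hY ?_
  have h1 : (Y : Space d) + x ∈ Metric.closedBall 0 R := hR (subset_tsupport _ hne)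
  rw [mem_closedBall_zero_iff] at h1
  have h2 : ‖x‖ ≤ ‖x₀‖ + 1 := by
    have := norm_sub_norm_le x x₀
    rw [Metric.mem_ball, dist_eq_norm] at hx
    linarith
  have h3 : ‖(Y : Space d)‖ ≤ ‖(Y : Space d) + x‖ + ‖x‖ := by
    simpa using norm_sub_le ((Y : Space d) + x) x
  simp only [Set.Finite.mem_toFinset, Set.mem_ofPred_eq]
  linarith

theorem periodize_eq_sum (Q : UnitCell d) {φ : Space d → ℝ} {F : Finset Q.lattice} {x : Space d}
    (h : ∀ Y ∉ F, φ (Y + x) = 0) : Q.periodize φ x = ∑ Y ∈ F, φ (Y + x) :=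
  tsum_eq_sum h

theorem summable_translates (Q : UnitCell d) {φ : Space d → ℝ} (hφ : HasCompactSupport φ)
    (x : Space d) : Summable fun Y : Q.lattice => φ (Y + x) := by
  obtain ⟨F, hF⟩ := Q.exists_finset_translates hφ x
  exact summable_of_ne_finset_zero (hF x (Metric.mem_ball_self one_pos))

theorem periodize_add_mem (Q : UnitCell d) (φ : Space d → ℝ) (Z : Q.lattice) (x : Space d) :
    Q.periodize φ (Z + x) = Q.periodize φ x := by
  have h := (Equiv.addRight Z).tsum_eq fun Y : Q.lattice => φ (Y + x)
  simpa only [periodize, Equiv.coe_addRight, Submodule.coe_add, add_assoc] using h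

theorem periodize_mul (Q : UnitCell d) {ψ : Space d → ℝ} (φ : Space d → ℝ)
    (hψ : ∀ Z : Q.lattice, ∀ x, ψ (Z + x) = ψ x) (x : Space d) :
    Q.periodize (fun y => ψ y * φ y) x = ψ x * Q.periodize φ x := by
  simp only [periodize, hψ, tsum_mul_left]

theorem contDiff_periodize (Q : UnitCell d) {φ : Space d → ℝ} (hφ : HasCompactSupport φ)
    {n : WithTop ℕ∞} (h : ContDiff ℝ n φ) : ContDiff ℝ n (Q.periodize φ) := by
  rw [contDiff_iff_contDiffAt]
  intro x₀
  obtain ⟨F, hF⟩ := Q.exists_finset_translates hφ x₀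
  have h1 : ContDiff ℝ n fun x => ∑ Y ∈ F, φ (Y + x) :=
    ContDiff.sum fun Y _ => h.comp (contDiff_const.add contDiff_id)
  refine h1.contDiffAt.congr_of_eventuallyEq ?_
  filter_upwards [Metric.ball_mem_nhds x₀ one_pos] with x hx
  exact Q.periodize_eq_sum (hF x hx)

theorem continuous_periodize (Q : UnitCell d) {φ : Space d → ℝ} (hφ : HasCompactSupport φ)
    (h : Continuous φ) : Continuous (Q.periodize φ) := by
  rw [← contDiff_zero (𝕜 := ℝ)] at h ⊢
  exact Q.contDiff_periodize hφ h

theorem pderiv_periodize (Q : UnitCell d) {φ : Space d → ℝ} (hφ : IsTest φ) (j : Fin d)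
    (x₀ : Space d) : pderiv j (Q.periodize φ) x₀ = Q.periodize (pderiv j φ) x₀ := by
  obtain ⟨F, hF⟩ := Q.exists_finset_translates hφ.compact x₀
  obtain ⟨F', hF'⟩ := Q.exists_finset_translates (hφ.hasCompactSupport_pderiv j) x₀
  classical
  -- The union lets the sums for `φ` and for its derivative run over the same index set.
  have h0 : Q.periodize φ =ᶠ[𝓝 x₀] fun x => ∑ Y ∈ F ∪ F', φ (Y + x) := by
    filter_upwards [Metric.ball_mem_nhds x₀ one_pos] with x hx
    exact Q.periodize_eq_sum fun Y hY => hF x hx Y (by simp at hY; tauto)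
  have hd : ∀ Y : Q.lattice, DifferentiableAt ℝ (fun x => φ (Y + x)) x₀ := fun Y =>
    ((hφ.smooth.comp (contDiff_const.add contDiff_id)).differentiable (by simp)) x₀
  rw [Q.periodize_eq_sum (F := F ∪ F') fun Y hY =>
    hF' x₀ (Metric.mem_ball_self one_pos) Y (by simp at hY; tauto)]
  rw [pderiv, h0.fderiv_eq, fderiv_fun_sum fun Y _ => hd Y, FunLike.coe_sum, Finset.sum_apply]
  refine Finset.sum_congr rfl fun Y _ => ?_
  simp only [pderiv, add_comm (Y : Space d), fderiv_comp_add_right]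

/-- The lattice has a smooth, compactly supported, nonnegative partition of unity. -/
theorem exists_partition (Q : UnitCell d) :
    ∃ χ : Space d → ℝ, IsTest χ ∧ (∀ x, 0 ≤ χ x) ∧ ∀ x, Q.periodize χ x = 1 := by
  obtain ⟨R, hR⟩ := (ZSpan.fundamentalDomain_isBounded Q.Y).subset_closedBall (0 : Space d)
  -- The sign of `R` is not known; `|R| + 1` is a positive radius that is at least `R`.
  obtain ⟨θ, hθ1, hθ2⟩ : ∃ θ : ContDiffBump (0 : Space d), θ.rIn = |R| + 1 ∧ θ.rOut = |R| + 2 :=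
    ⟨⟨|R| + 1, |R| + 2, by positivity, by linarith⟩, rfl, rfl⟩
  -- Subtracting its integer part brings `x` into the fundamental parallelepiped, where the bump
  -- equals 1.
  have hcov : ∀ x, ∃ Y : Q.lattice, θ (Y + x) = 1 := by
    intro x
    refine ⟨-(ZSpan.floor Q.Y x), θ.one_of_mem_closedBall ?_⟩
    have := hR (ZSpan.fract_mem_fundamentalDomain Q.Y x)
    rw [hθ1]
    rw [ZSpan.fract_apply, sub_eq_neg_add] at this
    exact Metric.closedBall_subset_closedBall (by linarith [le_abs_self R]) this
  have hpos : ∀ x, 0 < Q.periodize θ x := by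
    intro x
    obtain ⟨Y, hY⟩ := hcov x
    have h := (Q.summable_translates θ.hasCompactSupport x).le_tsum Y fun _ _ => θ.nonneg
    rw [hY] at h
    exact one_pos.trans_le h
  have hper : ∀ (Z : Q.lattice) x, (Q.periodize θ (Z + x))⁻¹ = (Q.periodize θ x)⁻¹ := by
    intro Z x
    rw [Q.periodize_add_mem]
  -- The bump is divided by its own periodization, which is positive, smooth and periodic.
  refine ⟨fun x => (Q.periodize θ x)⁻¹ * θ x, ⟨?_, ?_⟩, ?_, ?_⟩
  · exact ((Q.contDiff_periodize θ.hasCompactSupport θ.contDiff).inv fun x => (hpos x).ne').mul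
      θ.contDiff
  · exact θ.hasCompactSupport.mul_left
  · intro x
    exact mul_nonneg (inv_nonneg.2 (hpos x).le) θ.nonneg
  · intro x
    rw [Q.periodize_mul θ hper]
    exact inv_mul_cancel₀ (hpos x).ne'

/-- Every smooth periodic function is the periodization of a test function. -/
theorem exists_test_periodize_eq (Q : UnitCell d) {ψ : Space d → ℝ} (hψ : ContDiff ℝ ∞ ψ)
    (hper : ∀ Z : Q.lattice, ∀ x, ψ (Z + x) = ψ x) :
    ∃ φ : Space d → ℝ, IsTest φ ∧ Q.periodize φ = ψ ∧
      ∀ j, Q.periodize (pderiv j φ) = pderiv j ψ := by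
  obtain ⟨χ, hχ, -, h1⟩ := Q.exists_partition
  -- The periodic factor `ψ` comes out of the lattice sum, and what remains is the periodization of
  -- `χ`, namely 1.
  have ht : IsTest fun x => ψ x * χ x := ⟨hψ.mul hχ.smooth, hχ.compact.mul_left⟩
  have he : Q.periodize (fun x => ψ x * χ x) = ψ := by
    funext x
    rw [Q.periodize_mul χ hper, h1, mul_one]
  refine ⟨_, ht, he, fun j => ?_⟩
  funext x
  rw [← Q.pderiv_periodize ht, he]

variable {Q : UnitCell d}

/-- Compactness is applied to the closed fundamental parallelepiped, because the cell `Q.V` itself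
may be unbounded. -/
theorem exists_bound_of_periodic (Q : UnitCell d) {ψ : Space d → ℝ} (hψ : Continuous ψ)
    (hper : ∀ Z : Q.lattice, ∀ x, ψ (Z + x) = ψ x) : ∃ C : ℝ, 0 ≤ C ∧ ∀ x, ‖ψ x‖ ≤ C := by
  obtain ⟨C, hC⟩ := (ZSpan.fundamentalDomain_isBounded
    Q.Y).isCompact_closure.exists_bound_of_continuousOn hψ.continuousOn
  have h : ∀ x, ‖ψ x‖ ≤ C := by
    intro x
    have h1 := hC _ (subset_closure (ZSpan.fract_mem_fundamentalDomain Q.Y x))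
    rwa [ZSpan.fract_apply, sub_eq_neg_add, ← Submodule.coe_neg, hper (-(ZSpan.floor Q.Y x))] at h1
  exact ⟨C, (norm_nonneg _).trans (h 0), h⟩

/-! ### Unfolding integrals from the cell to the whole space. -/

theorem restrict_eq (Q : UnitCell d) : volume.restrict Q.V = volume Q.V • Q.avg := by
  rw [avg, smul_smul, ENNReal.mul_inv_cancel Q.volume_ne_zero Q.volume_ne_top, one_smul]

/-- The volume of the cell. -/
def vol (Q : UnitCell d) : ℝ := (volume Q.V).toReal

theorem vol_pos (Q : UnitCell d) : 0 < Q.vol :=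
  ENNReal.toReal_pos Q.volume_ne_zero Q.volume_ne_top

theorem setIntegral_eq_vol_mul (Q : UnitCell d) (f : Space d → ℝ) :
    ∫ x in Q.V, f x = Q.vol * ∫ x, f x ∂Q.avg := by
  rw [Q.restrict_eq, integral_smul_measure, smul_eq_mul, vol]

theorem ae_avg {p : Space d → Prop} (h : ∀ᵐ x, p x) : ∀ᵐ x ∂Q.avg, p x :=
  Measure.ae_smul_measure (ae_restrict_of_ae h) _

/-- The space splits into the translates of the cell; each piece is moved back to the cell, and the
periodic factor does not notice. -/
theorem lintegral_mul_eq {f : Space d → ENNReal} (hf : AEMeasurable f)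
    (hper : ∀ Y : Q.lattice, ∀ᵐ x, f (Y + x) = f x) {g : Space d → ENNReal} (hg : Measurable g) :
    ∫⁻ x, f x * g x = ∫⁻ x in Q.V, f x * ∑' Y : Q.lattice, g (Y + x) := by
  rw [Q.isFundamental'.lintegral_eq_tsum'']
  simp only [← ENNReal.tsum_mul_left]
  have hm : ∀ Y : Q.lattice, AEMeasurable (fun x => f x * g (Y + x)) (volume.restrict Q.V) :=
    fun Y => hf.restrict.mul (hg.comp (measurable_const_add _)).aemeasurable
  rw [lintegral_tsum hm]
  refine tsum_congr fun Y => lintegral_congr_ae (ae_restrict_of_ae ?_)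
  filter_upwards [hper Y] with x hx
  change f (Y + x) * g (Y + x) = _
  rw [hx]

theorem integral_mul_eq {f φ : Space d → ℝ} (hf : AEStronglyMeasurable f)
    (hper : ∀ Y : Q.lattice, ∀ᵐ x, f (Y + x) = f x) (hφ : Continuous φ)
    (hi : Integrable fun x => f x * φ x) :
    ∫ x, f x * φ x = Q.vol * ∫ x, f x * Q.periodize φ x ∂Q.avg := by
  have h0 : ∀ Y : Q.lattice, (fun x => f (Y + x) * φ (Y + x)) =ᵐ[volume.restrict Q.V]
      fun x => f x * φ (Y + x) := by
    intro Y
    refine ae_restrict_of_ae ?_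
    filter_upwards [hper Y] with x hx
    rw [hx]
  rw [← setIntegral_eq_vol_mul, Q.isFundamental'.integral_eq_tsum'' _ hi]
  simp only [periodize, ← tsum_mul_left]
  rw [integral_tsum]
  · exact tsum_congr fun Y => integral_congr_ae (h0 Y)
  · exact fun Y => hf.restrict.mul (hφ.comp (continuous_const_add _)).aestronglyMeasurable
  -- The summability needed to exchange sum and integral is the unfolded form of the integrability
  -- of `f * φ`.
  · have h := hi.2
    rw [hasFiniteIntegral_iff_enorm, Q.isFundamental'.lintegral_eq_tsum''] at h
    refine ne_of_eq_of_ne (tsum_congr fun Y => ?_) h.ne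
    refine lintegral_congr_ae ?_
    filter_upwards [h0 Y] with x hx
    rw [← hx]
    rfl

namespace IsL2Per

variable {f : Space d → ℝ}

theorem locallyIntegrable (hf : Q.IsL2Per f) : LocallyIntegrable f := by
  rw [locallyIntegrable_iff]
  intro K hK
  have : IsFiniteMeasure (volume.restrict K) := ⟨by simpa using hK.measure_lt_top⟩
  exact (hf.local_memLp K hK).integrable (by norm_num)

theorem aestronglyMeasurable (hf : Q.IsL2Per f) : AEStronglyMeasurable f :=
  hf.locallyIntegrable.aestronglyMeasurable

theorem periodic' (hf : Q.IsL2Per f) (Y : Q.lattice) : ∀ᵐ x, f (Y + x) = f x := by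
  simpa only [add_comm] using hf.periodic Y Y.2

/-- Unfolding: an integral over the whole space against a test function is an integral over the
cell against its periodization. -/
theorem integral_mul (hf : Q.IsL2Per f) {φ : Space d → ℝ} (hφ : Continuous φ)
    (hc : HasCompactSupport φ) :
    ∫ x, f x * φ x = Q.vol * ∫ x, f x * Q.periodize φ x ∂Q.avg :=
  integral_mul_eq hf.aestronglyMeasurable hf.periodic' hφ (hf.integrable_mul hφ hc)

theorem memLp_avg (hf : Q.IsL2Per f) : MemLp f 2 Q.avg := by
  refine MemLp.smul_measure ?_ (ENNReal.inv_ne_top.2 Q.volume_ne_zero)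
  refine ⟨hf.aestronglyMeasurable.restrict, ?_⟩
  rw [eLpNorm_lt_top_iff_lintegral_rpow_enorm_lt_top (by norm_num) (by norm_num)]
  -- The cell may be unbounded, so local integrability says nothing about it directly. Weighting by
  -- the partition of unity replaces the integral over the cell by one over the compact support of
  -- `χ`.
  obtain ⟨χ, hχ, h0, h1⟩ := Q.exists_partition
  have hsum : ∀ x, ∑' Y : Q.lattice, ENNReal.ofReal (χ (Y + x)) = 1 := by
    intro x
    rw [← ENNReal.ofReal_tsum_of_nonneg (fun _ => h0 _) (Q.summable_translates hχ.compact x)]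
    change ENNReal.ofReal (Q.periodize χ x) = 1
    rw [h1, ENNReal.ofReal_one]
  have hle : ∀ x, ENNReal.ofReal (χ x) ≤ 1 := by
    intro x
    rw [← hsum x]
    simpa using ENNReal.le_tsum (f := fun Y : Q.lattice => ENNReal.ofReal (χ (Y + x))) 0
  have h := lintegral_mul_eq (Q := Q) (f := fun x => ‖f x‖ₑ ^ (2 : ENNReal).toReal)
    (g := fun x => ENNReal.ofReal (χ x))
    (hf.aestronglyMeasurable.enorm.pow_const _)
    (fun Y => by filter_upwards [hf.periodic' Y] with x hx; rw [hx])
    (ENNReal.measurable_ofReal.comp hχ.smooth.continuous.measurable)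
  simp only [hsum, mul_one] at h
  rw [← h]
  have hK := (hf.local_memLp _ hχ.compact).2
  rw [eLpNorm_lt_top_iff_lintegral_rpow_enorm_lt_top (by norm_num) (by norm_num)] at hK
  refine lt_of_le_of_lt ?_ hK
  rw [← lintegral_indicator (isClosed_tsupport χ).measurableSet]
  refine lintegral_mono fun x => ?_
  by_cases hx : x ∈ tsupport χ
  · rw [Set.indicator_of_mem hx]
    exact mul_le_of_le_one_right' (hle x)
  · rw [image_eq_zero_of_notMem_tsupport hx]
    simp

end IsL2Per

/-- A compact set is dominated by a bump function whose periodization is bounded by some `C`, so the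
integral of `|f|²` over it is at most `C` times the integral over the cell. -/
theorem isL2Per_of_memLp {f : Space d → ℝ} (hm : AEStronglyMeasurable f)
    (hper : ∀ Y : Q.lattice, ∀ x, f (Y + x) = f x) (hf : MemLp f 2 Q.avg) : Q.IsL2Per f := by
  refine ⟨fun Y hY => .of_forall fun x => by rw [add_comm]; exact hper ⟨Y, hY⟩ x,
    fun K hK => ⟨hm.restrict, ?_⟩⟩
  rw [eLpNorm_lt_top_iff_lintegral_rpow_enorm_lt_top (by norm_num) (by norm_num)]
  obtain ⟨R, hR⟩ := hK.isBounded.subset_closedBall (0 : Space d)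
  obtain ⟨θ, hθ⟩ : ∃ θ : ContDiffBump (0 : Space d), θ.rIn = |R| + 1 :=
    ⟨⟨|R| + 1, |R| + 2, by positivity, by linarith⟩, rfl⟩
  have hθK : ∀ x ∈ K, θ x = 1 := by
    intro x hx
    refine θ.one_of_mem_closedBall ?_
    rw [hθ]
    exact Metric.closedBall_subset_closedBall (by linarith [le_abs_self R]) (hR hx)
  obtain ⟨C, hC0, hC⟩ := Q.exists_bound_of_periodic
    (Q.continuous_periodize θ.hasCompactSupport θ.continuous) (Q.periodize_add_mem θ)
  have hsum : ∀ x, ∑' Y : Q.lattice, ENNReal.ofReal (θ (Y + x)) ≤ ENNReal.ofReal C := by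
    intro x
    rw [← ENNReal.ofReal_tsum_of_nonneg (fun _ => θ.nonneg)
      (Q.summable_translates θ.hasCompactSupport x)]
    exact ENNReal.ofReal_le_ofReal ((le_abs_self _).trans (hC x))
  have h := lintegral_mul_eq (Q := Q) (f := fun x => ‖f x‖ₑ ^ (2 : ENNReal).toReal)
    (g := fun x => ENNReal.ofReal (θ x)) (hm.enorm.pow_const _)
    (fun Y => .of_forall fun x => by rw [hper])
    (ENNReal.measurable_ofReal.comp θ.continuous.measurable)
  have hV := (hf.smul_measure Q.volume_ne_top).2
  rw [← restrict_eq, eLpNorm_lt_top_iff_lintegral_rpow_enorm_lt_top (by norm_num) (by norm_num)]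
    at hV
  calc ∫⁻ x in K, ‖f x‖ₑ ^ (2 : ENNReal).toReal
      ≤ ∫⁻ x, ‖f x‖ₑ ^ (2 : ENNReal).toReal * ENNReal.ofReal (θ x) := by
        rw [← lintegral_indicator hK.measurableSet]
        refine lintegral_mono fun x => ?_
        by_cases hx : x ∈ K
        · simp [hx, hθK x hx]
        · simp [hx]
    _ = _ := h
    _ ≤ ∫⁻ x in Q.V, ‖f x‖ₑ ^ (2 : ENNReal).toReal * ENNReal.ofReal C :=
        lintegral_mono fun x => mul_le_mul_right (hsum x) _
    _ < ⊤ := by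
        rw [lintegral_mul_const' _ _ ENNReal.ofReal_ne_top]
        exact ENNReal.mul_lt_top hV ENNReal.ofReal_lt_top

/-- Every square integrable function on the cell has a periodic extension. -/
theorem exists_periodic_extension {f : Space d → ℝ} (hf : MemLp f 2 Q.avg) :
    ∃ g : Space d → ℝ, Q.IsL2Per g ∧ f =ᵐ[Q.avg] g := by
  -- The cell is only null measurable; a measurable subset of full measure makes the extension
  -- measurable.
  obtain ⟨W, hWV, hWm, hWe⟩ :=
    Q.isFundamental'.nullMeasurableSet.exists_measurable_subset_ae_eq
  let f₀ : Space d → ℝ := W.indicator (hf.1.mk f)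
  have hf₀ : Measurable f₀ := hf.1.stronglyMeasurable_mk.measurable.indicator hWm
  -- `ENNReal.ofReal` keeps the positive part, so the lattice sum is measurable and invariant under
  -- reindexing without any convergence question. The negative part is handled by applying `P` to
  -- `-f₀`.
  let P : (Space d → ℝ) → Space d → ℝ := fun u x =>
    (∑' Y : Q.lattice, ENNReal.ofReal (u (Y + x))).toReal
  have hP : ∀ u, Measurable u → Measurable (P u) := fun u hu =>
    (Measurable.tsum fun Y =>
      ENNReal.measurable_ofReal.comp (hu.comp (measurable_const_add _))).ennreal_toReal
  have hPper : ∀ u (Z : Q.lattice) x, P u (Z + x) = P u x := by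
    intro u Z x
    have h := (Equiv.addRight Z).tsum_eq fun Y : Q.lattice => ENNReal.ofReal (u (Y + x))
    simp only [Equiv.coe_addRight, Submodule.coe_add, add_assoc] at h
    simp only [P, h]
  let g : Space d → ℝ := fun x => P f₀ x - P (fun y => -f₀ y) x
  have hgm : Measurable g := (hP _ hf₀).sub (hP _ hf₀.neg)
  have hg : ∀ (Z : Q.lattice) x, g (Z + x) = g x := fun Z x => by simp only [g, hPper]
  -- Distinct translates of the cell overlap in null sets, so on the cell only the term `Y = 0` of
  -- the lattice sum survives.
  have hdisj : ∀ᵐ x ∂volume.restrict Q.V, ∀ Y : Q.lattice, Y ≠ 0 → f₀ (Y + x) = 0 := by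
    rw [ae_all_iff]
    intro Y
    by_cases hY : Y = 0
    · exact .of_forall fun x h => absurd hY h
    have h1 := Q.isFundamental'.aedisjoint
      (show (0 : Q.lattice) ≠ -Y from fun h => hY (by simpa using h.symm))
    rw [ae_restrict_iff'₀ Q.isFundamental'.nullMeasurableSet]
    have h2 := measure_eq_zero_iff_ae_notMem.1 h1
    filter_upwards [h2] with x hx hxV _
    refine Set.indicator_of_notMem (fun hW => hx ⟨⟨x, hxV, zero_vadd _ x⟩, ?_⟩) _
    rw [Set.mem_neg_vadd_set_iff]
    exact hWV hW
  have hmem : ∀ᵐ x ∂volume.restrict Q.V, x ∈ W := by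
    rw [← Measure.restrict_congr_set hWe]
    exact ae_restrict_mem hWm
  have hfg : f =ᵐ[Q.avg] g := by
    filter_upwards [Measure.ae_smul_measure hdisj (volume Q.V)⁻¹,
      Measure.ae_smul_measure hmem (volume Q.V)⁻¹, hf.1.ae_eq_mk] with x h1 h2 h3
    have h4 : f₀ x = f x := by rw [h3]; exact Set.indicator_of_mem h2 _
    have h5 : P f₀ x = (ENNReal.ofReal (f x)).toReal := by
      simp only [P]
      rw [tsum_eq_single 0 fun Y hY => by rw [h1 Y hY, ENNReal.ofReal_zero]]
      simp [h4]
    have h6 : P (fun y => -f₀ y) x = (ENNReal.ofReal (-f x)).toReal := by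
      simp only [P]
      rw [tsum_eq_single 0 fun Y hY => by rw [h1 Y hY, neg_zero, ENNReal.ofReal_zero]]
      simp [h4]
    simp only [g]
    rw [h5, h6, ENNReal.toReal_ofReal', ENNReal.toReal_ofReal']
    exact (max_zero_sub_eq_self (f x)).symm
  exact ⟨g, isL2Per_of_memLp hgm.aestronglyMeasurable hg (hf.ae_eq hfg), hfg⟩

end UnitCell

/-- Integration by parts against a test function. -/
theorem IsTest.integral_mul_pderiv {φ ψ : Space d → ℝ} (hφ : IsTest φ)
    (hψ : ContDiff ℝ ∞ ψ) (j : Fin d) : ∫ x, ψ x * pderiv j φ x = -∫ x, pderiv j ψ x * φ x := by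
  have hc : Continuous (pderiv j ψ) :=
    (hψ.continuous_fderiv (by simp)).clm_apply continuous_const
  exact integral_mul_fderiv_eq_neg_fderiv_mul_of_integrable
    ((hc.mul hφ.smooth.continuous).integrable_of_hasCompactSupport hφ.compact.mul_left)
    ((hψ.continuous.mul (hφ.continuous_pderiv j)).integrable_of_hasCompactSupport
      (hφ.hasCompactSupport_pderiv j).mul_left)
    ((hψ.continuous.mul hφ.smooth.continuous).integrable_of_hasCompactSupport hφ.compact.mul_left)
    (fun x _ => hψ.differentiable (by simp) x) (fun x _ => hφ.smooth.differentiable (by simp) x)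

namespace UnitCell

variable {Q : UnitCell d}

theorem IsL2Per.const (Q : UnitCell d) (c : ℝ) : Q.IsL2Per fun _ => c := by
  refine ⟨fun _ _ => by simp, fun K hK => ?_⟩
  have : IsFiniteMeasure (volume.restrict K) := ⟨by simpa using hK.measure_lt_top⟩
  exact memLp_const c

/-- Since `ψ` is the periodization of a test function `φ`, the integral unfolds to that of `∂φ/∂x_j`
over the whole space. -/
theorem integral_pderiv_eq_zero {ψ : Space d → ℝ} (hψ : ContDiff ℝ ∞ ψ)
    (hper : ∀ Z : Q.lattice, ∀ x, ψ (Z + x) = ψ x) (j : Fin d) :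
    ∫ x, pderiv j ψ x ∂Q.avg = 0 := by
  obtain ⟨φ, hφ, -, h2⟩ := Q.exists_test_periodize_eq hψ hper
  have h := (IsL2Per.const Q 1).integral_mul (hφ.continuous_pderiv j)
    (hφ.hasCompactSupport_pderiv j)
  rw [hφ.integral_mul_pderiv contDiff_const, h2] at h
  simpa [pderiv, Q.vol_pos.ne'] using h.symm

/-! ### Plane waves -/

/-- The phase `x ↦ 2π ∑ l, k l * y l` of the plane wave of index `k`, where the `y l` are the
coordinates of `x` in the basis of the lattice. -/
def phase (Q : UnitCell d) (k : Fin d → ℤ) : Space d →L[ℝ] ℝ :=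
  ∑ l, (2 * Real.pi * k l) • (Q.Y.coord l).toContinuousLinearMap

/-- The wave vector of the plane wave of index `k`. -/
def waveVec (Q : UnitCell d) (k : Fin d → ℤ) (j : Fin d) : ℝ :=
  Q.phase k (EuclideanSpace.single j 1)

theorem phase_apply (k : Fin d → ℤ) (x : Space d) :
    Q.phase k x = ∑ l, 2 * Real.pi * k l * Q.Y.repr x l := by
  simp [phase]

theorem phase_sub (k m : Fin d → ℤ) (x : Space d) :
    Q.phase (k - m) x = Q.phase k x - Q.phase m x := by
  simp only [phase_apply, ← Finset.sum_sub_distrib]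
  refine Finset.sum_congr rfl fun l _ => ?_
  simp
  ring

theorem phase_eq_sum (k : Fin d → ℤ) (x : Space d) :
    Q.phase k x = ∑ j, Q.waveVec k j * x j := by
  conv_lhs => rw [← (EuclideanSpace.basisFun (Fin d) ℝ).sum_repr x]
  rw [map_sum]
  refine Finset.sum_congr rfl fun j _ => ?_
  rw [map_smul, smul_eq_mul, mul_comm]
  simp [waveVec]

theorem phase_basis (k : Fin d → ℤ) (l : Fin d) : Q.phase k (Q.Y l) = 2 * Real.pi * k l := by
  classical
  rw [phase_apply, Finset.sum_eq_single l]
  · simp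
  · intro m _ hm
    simp [hm.symm]
  · simp

theorem exists_phase_lattice (k : Fin d → ℤ) (Z : Q.lattice) :
    ∃ n : ℤ, Q.phase k Z = n * (2 * Real.pi) := by
  have h := (Q.Y.mem_span_iff_repr_mem ℤ (Z : Space d)).1 Z.2
  choose n hn using h
  refine ⟨∑ l, k l * n l, ?_⟩
  rw [phase_apply, Int.cast_sum, Finset.sum_mul]
  refine Finset.sum_congr rfl fun l _ => ?_
  rw [← hn]
  simp
  ring

/-- If `k l ≠ 0`, the phase at `Y l` is `2π k l`, of modulus at least 1, and Cauchy–Schwarz bounds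
its square by the product of the squared lengths of the wave vector and of `Y l`. This spectral gap
is the source of Poincaré's inequality. -/
theorem exists_waveVec_bound (Q : UnitCell d) :
    ∃ C : ℝ, 0 ≤ C ∧ ∀ k : Fin d → ℤ, k ≠ 0 → 1 ≤ C * ∑ j, Q.waveVec k j ^ 2 := by
  refine ⟨∑ l, ∑ j, Q.Y l j ^ 2, by positivity, fun k hk => ?_⟩
  obtain ⟨l, hl⟩ := Function.ne_iff.1 hk
  have h1 : (Q.phase k (Q.Y l)) ^ 2 ≤ (∑ j, Q.waveVec k j ^ 2) * ∑ j, Q.Y l j ^ 2 := by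
    rw [phase_eq_sum]
    exact Finset.sum_mul_sq_le_sq_mul_sq _ _ _
  have h2 : 1 ≤ (Q.phase k (Q.Y l)) ^ 2 := by
    rw [phase_basis, ← sq_abs, abs_mul]
    have h3 : (1 : ℝ) ≤ |(k l : ℝ)| := by exact_mod_cast Int.one_le_abs hl
    have h4 : 1 ≤ |2 * Real.pi| := by
      rw [abs_of_pos (by positivity)]
      linarith [Real.pi_gt_three]
    exact one_le_pow₀ (one_le_mul_of_one_le_of_one_le h4 h3)
  have h3 : ∑ j, Q.Y l j ^ 2 ≤ ∑ l, ∑ j, Q.Y l j ^ 2 :=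
    Finset.single_le_sum (f := fun l => ∑ j, Q.Y l j ^ 2)
      (fun _ _ => Finset.sum_nonneg fun _ _ => sq_nonneg _) (Finset.mem_univ l)
  calc (1 : ℝ) ≤ _ := h2.trans h1
    _ ≤ (∑ j, Q.waveVec k j ^ 2) * ∑ l, ∑ j, Q.Y l j ^ 2 :=
      mul_le_mul_of_nonneg_left h3 (by positivity)
    _ = _ := mul_comm _ _

/-- The real part of the plane wave of index `k`. -/
def cosWave (Q : UnitCell d) (k : Fin d → ℤ) (x : Space d) : ℝ := Real.cos (Q.phase k x)

/-- The imaginary part of the plane wave of index `k`. -/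
def sinWave (Q : UnitCell d) (k : Fin d → ℤ) (x : Space d) : ℝ := Real.sin (Q.phase k x)

theorem cosWave_periodic (k : Fin d → ℤ) (Z : Q.lattice) (x : Space d) :
    Q.cosWave k (Z + x) = Q.cosWave k x := by
  obtain ⟨n, hn⟩ := exists_phase_lattice k Z
  rw [cosWave, cosWave, map_add, hn, add_comm, Real.cos_add_int_mul_two_pi]

theorem sinWave_periodic (k : Fin d → ℤ) (Z : Q.lattice) (x : Space d) :
    Q.sinWave k (Z + x) = Q.sinWave k x := by
  obtain ⟨n, hn⟩ := exists_phase_lattice k Z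
  rw [sinWave, sinWave, map_add, hn, add_comm, Real.sin_add_int_mul_two_pi]

theorem contDiff_cosWave (k : Fin d → ℤ) : ContDiff ℝ ∞ (Q.cosWave k) :=
  Real.contDiff_cos.comp (Q.phase k).contDiff

theorem contDiff_sinWave (k : Fin d → ℤ) : ContDiff ℝ ∞ (Q.sinWave k) :=
  Real.contDiff_sin.comp (Q.phase k).contDiff

theorem pderiv_cosWave (k : Fin d → ℤ) (j : Fin d) (x : Space d) :
    pderiv j (Q.cosWave k) x = -(Q.waveVec k j) * Q.sinWave k x := by
  have h : HasFDerivAt (Q.cosWave k) (-Real.sin (Q.phase k x) • Q.phase k) x :=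
    (Q.phase k).hasFDerivAt.cos
  rw [pderiv, h.fderiv]
  simp [waveVec, sinWave]
  ring

theorem pderiv_sinWave (k : Fin d → ℤ) (j : Fin d) (x : Space d) :
    pderiv j (Q.sinWave k) x = Q.waveVec k j * Q.cosWave k x := by
  have h : HasFDerivAt (Q.sinWave k) (Real.cos (Q.phase k x) • Q.phase k) x :=
    (Q.phase k).hasFDerivAt.sin
  rw [pderiv, h.fderiv]
  simp [waveVec, cosWave]
  ring

theorem norm_cosWave_le (k : Fin d → ℤ) (x : Space d) : ‖Q.cosWave k x‖ ≤ 1 :=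
  Real.abs_cos_le_one _

theorem norm_sinWave_le (k : Fin d → ℤ) (x : Space d) : ‖Q.sinWave k x‖ ≤ 1 :=
  Real.abs_sin_le_one _

theorem integrable_mul_cosWave {f : Space d → ℝ} (hf : Integrable f Q.avg) (k : Fin d → ℤ) :
    Integrable (fun x => f x * Q.cosWave k x) Q.avg :=
  hf.mul_bdd (c := 1) (contDiff_cosWave k).continuous.aestronglyMeasurable
    (.of_forall (norm_cosWave_le k))

theorem integrable_mul_sinWave {f : Space d → ℝ} (hf : Integrable f Q.avg) (k : Fin d → ℤ) :
    Integrable (fun x => f x * Q.sinWave k x) Q.avg :=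
  hf.mul_bdd (c := 1) (contDiff_sinWave k).continuous.aestronglyMeasurable
    (.of_forall (norm_sinWave_le k))

/-- Each wave is, up to a nonzero component of the wave vector, a derivative of the other one. -/
theorem integral_waves_eq_zero {k : Fin d → ℤ} (hk : k ≠ 0) :
    ∫ x, Q.cosWave k x ∂Q.avg = 0 ∧ ∫ x, Q.sinWave k x ∂Q.avg = 0 := by
  obtain ⟨C, -, hC⟩ := Q.exists_waveVec_bound
  obtain ⟨j, hj⟩ : ∃ j, Q.waveVec k j ≠ 0 := by
    by_contra! h
    have := hC k hk
    simp only [h] at this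
    norm_num at this
  have h1 := integral_pderiv_eq_zero (contDiff_sinWave k) (sinWave_periodic (Q := Q) k) j
  have h2 := integral_pderiv_eq_zero (contDiff_cosWave k) (cosWave_periodic (Q := Q) k) j
  simp only [pderiv_sinWave, pderiv_cosWave, integral_const_mul] at h1 h2
  exact ⟨(mul_eq_zero.1 h1).resolve_left hj, (mul_eq_zero.1 h2).resolve_left (neg_ne_zero.2 hj)⟩

/-- The complex plane wave of index `k`. -/
def wave (Q : UnitCell d) (k : Fin d → ℤ) (x : Space d) : ℂ :=
  ⟨Q.cosWave k x, Q.sinWave k x⟩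

theorem wave_eq_exp (k : Fin d → ℤ) (x : Space d) :
    Q.wave k x = Complex.exp ((Q.phase k x : ℂ) * Complex.I) := by
  apply Complex.ext
  · rw [Complex.exp_ofReal_mul_I_re, wave, cosWave]
  · rw [Complex.exp_ofReal_mul_I_im, wave, sinWave]

theorem continuous_wave (k : Fin d → ℤ) : Continuous (Q.wave k) := by
  simp only [funext (wave_eq_exp k)]
  fun_prop

theorem norm_wave (k : Fin d → ℤ) (x : Space d) : ‖Q.wave k x‖ = 1 := by
  rw [wave_eq_exp, Complex.norm_exp_ofReal_mul_I]

theorem wave_mul_conj (k m : Fin d → ℤ) (x : Space d) :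
    Q.wave m x * (starRingEnd ℂ) (Q.wave k x) = Q.wave (m - k) x := by
  rw [wave_eq_exp, wave_eq_exp, wave_eq_exp, ← Complex.exp_conj, ← Complex.exp_add, phase_sub]
  congr 1
  simp
  ring

theorem memLp_wave (k : Fin d → ℤ) : MemLp (Q.wave k) 2 Q.avg :=
  MemLp.of_bound (continuous_wave k).aestronglyMeasurable 1
    (.of_forall fun x => (norm_wave k x).le)

theorem integral_wave (k : Fin d → ℤ) :
    ∫ x, Q.wave k x ∂Q.avg = if k = 0 then 1 else 0 := by
  have hi : Integrable (Q.wave k) Q.avg := (memLp_wave k).integrable (by norm_num)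
  split_ifs with h
  · subst h
    have : Q.wave 0 = fun _ => 1 := by
      funext x
      rw [wave_eq_exp, phase_apply]
      simp
    simp [this]
  · apply Complex.ext
    · have := integral_re hi
      exact this.symm.trans (integral_waves_eq_zero h).1
    · have := integral_im hi
      exact this.symm.trans (integral_waves_eq_zero h).2

/-- The plane waves as elements of `L²`. -/
def waveLp (Q : UnitCell d) (k : Fin d → ℤ) : Lp ℂ 2 Q.avg := (memLp_wave k).toLp _

theorem inner_waveLp {f : Space d → ℂ} (hf : MemLp f 2 Q.avg) (k : Fin d → ℤ) :
    inner ℂ (Q.waveLp k) (hf.toLp f) = ∫ x, f x * (starRingEnd ℂ) (Q.wave k x) ∂Q.avg := by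
  rw [L2.inner_def]
  refine integral_congr_ae ?_
  filter_upwards [hf.coeFn_toLp, (memLp_wave (Q := Q) k).coeFn_toLp] with x h1 h2
  rw [h1, waveLp, h2, RCLike.inner_apply]

theorem orthonormal_waveLp (Q : UnitCell d) : Orthonormal ℂ Q.waveLp := by
  classical
  rw [orthonormal_iff_ite]
  intro k m
  rw [waveLp, waveLp]
  change inner ℂ (Q.waveLp k) _ = _
  rw [inner_waveLp]
  simp only [wave_mul_conj]
  rw [integral_wave]
  simp only [sub_eq_zero, eq_comm]

/-! ### Completeness of the plane waves -/

/-- The projection of the space onto the torus, given by the coordinates in the basis of the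
lattice. -/
def toTorus (Q : UnitCell d) (x : Space d) : UnitAddTorus (Fin d) :=
  fun l => ((Q.Y.repr x l : ℝ) : UnitAddCircle)

/-- This is what makes a continuous periodic function descend to a continuous function on the torus.
-/
theorem toTorus_isQuotientMap (Q : UnitCell d) : IsQuotientMap Q.toTorus := by
  have h1 : IsOpenQuotientMap (Pi.map fun (_ : Fin d) (t : ℝ) => (t : UnitAddCircle)) :=
    IsOpenQuotientMap.piMap fun _ => QuotientAddGroup.isOpenQuotientMap_mk
  have h2 := h1.comp Q.Y.equivFunL.toHomeomorph.isOpenQuotientMap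
  exact h2.isQuotientMap

theorem mFourier_toTorus (k : Fin d → ℤ) (x : Space d) :
    UnitAddTorus.mFourier k (Q.toTorus x) = Q.wave k x := by
  rw [wave_eq_exp, phase_apply]
  simp only [UnitAddTorus.mFourier, toTorus, ContinuousMap.coe_mk, fourier_coe_apply]
  rw [← Complex.exp_sum]
  congr 1
  push_cast
  rw [Finset.sum_mul]
  refine Finset.sum_congr rfl fun l _ => ?_
  ring

theorem exists_eq_comp_toTorus {ψ : Space d → ℝ} (hψ : Continuous ψ)
    (hper : ∀ Z : Q.lattice, ∀ x, ψ (Z + x) = ψ x) :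
    ∃ F : C(UnitAddTorus (Fin d), ℂ), ∀ x, F (Q.toTorus x) = ψ x := by
  have hq := Q.toTorus_isQuotientMap
  have hlift : ∀ a b, Q.toTorus a = Q.toTorus b → (ψ a : ℂ) = ψ b := by
    intro a b hab
    have hZ : a - b ∈ Q.lattice := by
      refine (Q.Y.mem_span_iff_repr_mem ℤ _).2 fun l => ?_
      have h := congrFun hab l
      simp only [toTorus] at h
      rw [← sub_eq_zero, ← AddCircle.coe_sub, AddCircle.coe_eq_zero_iff] at h
      obtain ⟨n, hn⟩ := h
      exact ⟨n, by simpa using hn⟩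
    have h := hper ⟨a - b, hZ⟩ b
    rw [← h]
    simp
  refine ⟨hq.lift (f := ⟨Q.toTorus, hq.continuous⟩)
    ⟨fun x => (ψ x : ℂ), Complex.continuous_ofReal.comp hψ⟩ hlift, fun x => ?_⟩
  exact hq.lift_comp (f := ⟨Q.toTorus, hq.continuous⟩)
    ⟨fun x => (ψ x : ℂ), Complex.continuous_ofReal.comp hψ⟩ hlift |> fun h => DFunLike.congr_fun h x

/-- The integral is a functional of `F`, continuous for the supremum norm, that vanishes on the
monomials, whose span is dense. No comparison of `Q.avg` with the Haar measure of the torus is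
needed. -/
theorem integral_comp_toTorus_eq_zero {g : Space d → ℂ} (hg : Integrable g Q.avg)
    (h : ∀ k, ∫ x, g x * Q.wave k x ∂Q.avg = 0) (F : C(UnitAddTorus (Fin d), ℂ)) :
    ∫ x, g x * F (Q.toTorus x) ∂Q.avg = 0 := by
  have hc : Continuous Q.toTorus := Q.toTorus_isQuotientMap.continuous
  have hi : ∀ F : C(UnitAddTorus (Fin d), ℂ),
      Integrable (fun x => g x * F (Q.toTorus x)) Q.avg := fun F =>
    hg.mul_bdd (c := ‖F‖) (F.continuous.comp hc).aestronglyMeasurable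
      (.of_forall fun x => F.norm_coe_le_norm _)
  let Φ : C(UnitAddTorus (Fin d), ℂ) →L[ℂ] ℂ := LinearMap.mkContinuous
    { toFun := fun F => ∫ x, g x * F (Q.toTorus x) ∂Q.avg
      map_add' := fun F G => by
        simp only [ContinuousMap.add_apply, mul_add]
        exact integral_add (hi F) (hi G)
      map_smul' := fun c F => by
        simp only [ContinuousMap.smul_apply, smul_eq_mul, RingHom.id_apply, ← integral_const_mul]
        congr 1
        funext x
        ring }
    (∫ x, ‖g x‖ ∂Q.avg) fun F => by
      change ‖∫ x, g x * F (Q.toTorus x) ∂Q.avg‖ ≤ _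
      rw [← integral_mul_const]
      refine norm_integral_le_of_norm_le (hg.norm.mul_const _) (.of_forall fun x => ?_)
      rw [norm_mul]
      exact mul_le_mul_of_nonneg_left (F.norm_coe_le_norm _) (norm_nonneg _)
  have hle : (Submodule.span ℂ (Set.range (UnitAddTorus.mFourier (d := Fin d)))).topologicalClosure
      ≤ LinearMap.ker Φ.toLinearMap := by
    refine Submodule.topologicalClosure_minimal _ (Submodule.span_le.2 ?_) Φ.isClosed_ker
    rintro _ ⟨k, rfl⟩
    change ∫ x, g x * UnitAddTorus.mFourier k (Q.toTorus x) ∂Q.avg = 0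
    simp only [mFourier_toTorus]
    exact h k
  rw [UnitAddTorus.span_mFourier_closure_eq_top] at hle
  exact hle (Submodule.mem_top (x := F))

/-- Extended by periodicity and unfolded, the hypothesis becomes that of the fundamental lemma of
the calculus of variations on `ℝ^d`. -/
theorem ae_eq_zero_of_integral_periodize {f : Space d → ℝ} (hf : MemLp f 2 Q.avg)
    (h : ∀ φ, IsTest φ → ∫ x, f x * Q.periodize φ x ∂Q.avg = 0) : f =ᵐ[Q.avg] 0 := by
  obtain ⟨g, hg, hfg⟩ := exists_periodic_extension hf
  refine hfg.trans (ae_avg ?_)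
  refine ae_eq_zero_of_integral_contDiff_smul_eq_zero hg.locallyIntegrable fun φ h1 h2 => ?_
  have h3 := hg.integral_mul h1.continuous h2
  have h4 : ∫ x, g x * Q.periodize φ x ∂Q.avg = 0 := by
    rw [← h φ ⟨h1, h2⟩]
    refine integral_congr_ae ?_
    filter_upwards [hfg] with x hx
    rw [hx]
  rw [h4, mul_zero] at h3
  simpa only [smul_eq_mul, mul_comm] using h3

/-- A field orthogonal to all the waves integrates to zero against every continuous function on the
torus, in particular against periodized test functions. -/
theorem waveLp_orthogonal_eq_bot (Q : UnitCell d) :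
    (Submodule.span ℂ (Set.range Q.waveLp))ᗮ = ⊥ := by
  rw [eq_bot_iff]
  intro g hg
  have hm := Lp.memLp g
  have hi : Integrable g Q.avg := hm.integrable (by norm_num)
  have h0 : ∀ k, ∫ x, g x * Q.wave k x ∂Q.avg = 0 := by
    intro k
    -- The scalar product conjugates the wave, hence the index `-k`.
    have h1 := hg (Q.waveLp (-k)) (Submodule.subset_span ⟨-k, rfl⟩)
    rw [← Lp.toLp_coeFn g hm, inner_waveLp] at h1
    rw [← h1]
    congr 1
    funext x
    have h2 := wave_mul_conj (Q := Q) (-k) 0 x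
    have h3 : Q.wave 0 x = 1 := by
      rw [wave_eq_exp, phase_apply]
      simp
    rw [h3, one_mul, zero_sub, neg_neg] at h2
    rw [h2]
  have h1 : ∀ φ, IsTest φ → ∫ x, g x * (Q.periodize φ x : ℂ) ∂Q.avg = 0 := by
    intro φ hφ
    obtain ⟨F, hF⟩ := exists_eq_comp_toTorus
      (Q.continuous_periodize hφ.compact hφ.smooth.continuous) (Q.periodize_add_mem φ)
    simp only [← hF]
    exact integral_comp_toTorus_eq_zero hi h0 F
  have hi2 : ∀ φ, IsTest φ → Integrable (fun x => g x * (Q.periodize φ x : ℂ)) Q.avg := by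
    intro φ hφ
    have hc := Q.continuous_periodize hφ.compact hφ.smooth.continuous
    obtain ⟨C, -, hC⟩ := Q.exists_bound_of_periodic hc (Q.periodize_add_mem φ)
    refine hi.mul_bdd (c := C) (Complex.continuous_ofReal.comp hc).aestronglyMeasurable
      (.of_forall fun x => ?_)
    simpa using hC x
  have hre := ae_eq_zero_of_integral_periodize hm.re fun φ hφ => by
    have h2 := integral_re (hi2 φ hφ)
    rw [h1 φ hφ] at h2
    simpa using h2
  have him := ae_eq_zero_of_integral_periodize hm.im fun φ hφ => by
    have h2 := integral_im (hi2 φ hφ)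
    rw [h1 φ hφ] at h2
    simpa using h2
  rw [Submodule.mem_bot, Lp.eq_zero_iff_ae_eq_zero]
  filter_upwards [hre, him] with x h2 h3
  exact Complex.ext h2 h3

/-! ### Parseval's identity -/

/-- The cosine Fourier coefficient. -/
def cosCoeff (Q : UnitCell d) (k : Fin d → ℤ) (f : Space d → ℝ) : ℝ :=
  ∫ x, f x * Q.cosWave k x ∂Q.avg

/-- The sine Fourier coefficient. -/
def sinCoeff (Q : UnitCell d) (k : Fin d → ℤ) (f : Space d → ℝ) : ℝ :=
  ∫ x, f x * Q.sinWave k x ∂Q.avg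

theorem inner_waveLp_ofReal {f : Space d → ℝ} (hf : MemLp f 2 Q.avg) (k : Fin d → ℤ) :
    inner ℂ (Q.waveLp k) (hf.ofReal (K := ℂ).toLp _) =
      (⟨Q.cosCoeff k f, -Q.sinCoeff k f⟩ : ℂ) := by
  rw [inner_waveLp]
  have hf1 : Integrable f Q.avg := hf.integrable (by norm_num)
  have hi : Integrable (fun x => ((f x : ℝ) : ℂ) * (starRingEnd ℂ) (Q.wave k x)) Q.avg :=
    hf1.ofReal.mul_bdd (c := 1)
      (Complex.continuous_conj.comp (continuous_wave k)).aestronglyMeasurable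
      (.of_forall fun x => by simp [norm_wave])
  apply Complex.ext
  · refine (integral_re hi).symm.trans ?_
    simp [wave, cosCoeff]
  · refine (integral_im hi).symm.trans ?_
    simp [wave, sinCoeff, integral_neg]

/-- Real part of the complex Parseval identity. No factor 2 appears, because `k` runs over all
frequencies, `k` and `-k` being counted separately. -/
theorem hasSum_coeff_mul {f g : Space d → ℝ} (hf : MemLp f 2 Q.avg) (hg : MemLp g 2 Q.avg) :
    HasSum (fun k => Q.cosCoeff k f * Q.cosCoeff k g + Q.sinCoeff k f * Q.sinCoeff k g)
      (∫ x, f x * g x ∂Q.avg) := by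
  let b := HilbertBasis.mkOfOrthogonalEqBot Q.orthonormal_waveLp Q.waveLp_orthogonal_eq_bot
  have hb : ∀ k, b k = Q.waveLp k := fun k =>
    congrFun (HilbertBasis.coe_mkOfOrthogonalEqBot Q.orthonormal_waveLp
      Q.waveLp_orthogonal_eq_bot) k
  have h := b.hasSum_inner_mul_inner (hf.ofReal (K := ℂ).toLp _) (hg.ofReal (K := ℂ).toLp _)
  have h2 := Complex.hasSum_re h
  convert h2 using 1
  · funext k
    rw [hb, ← inner_conj_symm, inner_waveLp_ofReal hf, inner_waveLp_ofReal hg]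
    simp
  · rw [L2.inner_def]
    have h3 : ∫ x, inner ℂ ((hf.ofReal (K := ℂ).toLp _) x) ((hg.ofReal (K := ℂ).toLp _) x) ∂Q.avg
        = ((∫ x, f x * g x ∂Q.avg : ℝ) : ℂ) := by
      rw [← integral_complex_ofReal]
      refine integral_congr_ae ?_
      filter_upwards [hf.ofReal (K := ℂ).coeFn_toLp, hg.ofReal (K := ℂ).coeFn_toLp] with x h1 h2
      rw [h1, h2, RCLike.inner_apply]
      simp [mul_comm]
    rw [h3, Complex.ofReal_re]

/-! ### Weak derivatives on the cell -/

/-- `g` is the weak partial derivative `∂f/∂x_j` of the function `f` on the cell, both extended by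
periodicity. -/
def IsCellPartial (Q : UnitCell d) (j : Fin d) (f g : Space d → ℝ) : Prop :=
  ∀ φ : Space d → ℝ, IsTest φ →
    ∫ x, f x * Q.periodize (pderiv j φ) x ∂Q.avg = -∫ x, g x * Q.periodize φ x ∂Q.avg

/-- Both sides unfold with the same factor `Q.vol`. Differentiation on `ℝ^d` thus becomes a
condition on the cell, where Fourier coefficients are available. -/
theorem IsL2Per.isWeakPartial_iff {f g : Space d → ℝ} (hf : Q.IsL2Per f) (hg : Q.IsL2Per g)
    (j : Fin d) : IsWeakPartial j f g ↔ Q.IsCellPartial j f g := by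
  refine forall₂_congr fun φ hφ => ?_
  rw [hf.integral_mul (hφ.continuous_pderiv j) (hφ.hasCompactSupport_pderiv j),
    hg.integral_mul hφ.smooth.continuous hφ.compact, ← mul_neg]
  exact mul_right_inj' Q.vol_pos.ne'

theorem IsL2Per.sum_integral_mul_pderiv {ι : Type*} [Fintype ι] {t : ι → Space d → ℝ}
    (ht : ∀ j, Q.IsL2Per (t j)) (v : ι → Fin d) {φ : Space d → ℝ} (hφ : IsTest φ) :
    ∑ j, ∫ x, t j x * pderiv (v j) φ x =
      Q.vol * ∑ j, ∫ x, t j x * Q.periodize (pderiv (v j) φ) x ∂Q.avg := by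
  rw [Finset.mul_sum]
  exact Finset.sum_congr rfl fun j _ => (ht j).integral_mul (hφ.continuous_pderiv _)
    (hφ.hasCompactSupport_pderiv _)

theorem IsCellPartial.congr {j : Fin d} {f g f' g' : Space d → ℝ} (h : Q.IsCellPartial j f g)
    (hf : f =ᵐ[Q.avg] f') (hg : g =ᵐ[Q.avg] g') : Q.IsCellPartial j f' g' := by
  intro φ hφ
  rw [← integral_congr_ae (hf.mono fun x hx => congrArg (· * Q.periodize (pderiv j φ) x) hx),
    ← integral_congr_ae (hg.mono fun x hx => congrArg (· * Q.periodize φ x) hx)]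
  exact h φ hφ

theorem IsCellPartial.integral_mul_pderiv {j : Fin d} {f g ψ : Space d → ℝ}
    (h : Q.IsCellPartial j f g) (hψ : ContDiff ℝ ∞ ψ)
    (hper : ∀ Z : Q.lattice, ∀ x, ψ (Z + x) = ψ x) :
    ∫ x, f x * pderiv j ψ x ∂Q.avg = -∫ x, g x * ψ x ∂Q.avg := by
  obtain ⟨φ, hφ, h1, h2⟩ := Q.exists_test_periodize_eq hψ hper
  have := h φ hφ
  rwa [h1, h2] at this

theorem IsCellPartial.cosCoeff_eq {j : Fin d} {f g : Space d → ℝ} (h : Q.IsCellPartial j f g)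
    (k : Fin d → ℤ) : Q.cosCoeff k g = Q.waveVec k j * Q.sinCoeff k f := by
  have h1 := h.integral_mul_pderiv (contDiff_cosWave k) (cosWave_periodic k)
  simp only [pderiv_cosWave, mul_left_comm (f _), integral_const_mul] at h1
  rw [cosCoeff, sinCoeff]
  linarith

theorem IsCellPartial.sinCoeff_eq {j : Fin d} {f g : Space d → ℝ} (h : Q.IsCellPartial j f g)
    (k : Fin d → ℤ) : Q.sinCoeff k g = -(Q.waveVec k j * Q.cosCoeff k f) := by
  have h1 := h.integral_mul_pderiv (contDiff_sinWave k) (sinWave_periodic k)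
  simp only [pderiv_sinWave, mul_left_comm (f _), integral_const_mul] at h1
  rw [cosCoeff, sinCoeff]
  linarith

@[simp]
theorem waveVec_zero (j : Fin d) : Q.waveVec 0 j = 0 := by
  simp [waveVec, phase_apply]

theorem cosCoeff_zero (f : Space d → ℝ) : Q.cosCoeff 0 f = ∫ x, f x ∂Q.avg := by
  simp [cosCoeff, cosWave, phase_apply]

theorem sinCoeff_zero (f : Space d → ℝ) : Q.sinCoeff 0 f = 0 := by
  simp [sinCoeff, sinWave, phase_apply]

/-- The average is the coefficient at frequency zero, where the wave vector vanishes. -/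
theorem IsCellPartial.integral_eq_zero {j : Fin d} {f g : Space d → ℝ}
    (h : Q.IsCellPartial j f g) : ∫ x, g x ∂Q.avg = 0 := by
  rw [← cosCoeff_zero, h.cosCoeff_eq]
  simp

theorem cosCoeff_symm {f g : Space d → ℝ} (hf : Integrable f Q.avg) (hg : Integrable g Q.avg)
    (k : Fin d → ℤ) :
    Q.cosCoeff k (fun x => 1 / 2 * (f x + g x)) = 1 / 2 * (Q.cosCoeff k f + Q.cosCoeff k g) := by
  simp only [cosCoeff, mul_assoc, add_mul, integral_const_mul]
  rw [integral_add (integrable_mul_cosWave hf k) (integrable_mul_cosWave hg k)]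

theorem sinCoeff_symm {f g : Space d → ℝ} (hf : Integrable f Q.avg) (hg : Integrable g Q.avg)
    (k : Fin d → ℤ) :
    Q.sinCoeff k (fun x => 1 / 2 * (f x + g x)) = 1 / 2 * (Q.sinCoeff k f + Q.sinCoeff k g) := by
  simp only [sinCoeff, mul_assoc, add_mul, integral_const_mul]
  rw [integral_add (integrable_mul_sinWave hf k) (integrable_mul_sinWave hg k)]

/-! ### The inequalities of Korn and Poincaré -/

/-- Korn's inequality at a single frequency: the right-hand side equals the left-hand side plus `(κ
· b)²`. -/
theorem sum_sq_le_two_mul_symm {ι : Type*} [Fintype ι] (κ b : ι → ℝ) :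
    ∑ i, ∑ j, (κ j * b i) ^ 2 ≤ 2 * ∑ i, ∑ j, (1 / 2 * (κ j * b i + κ i * b j)) ^ 2 := by
  have h1 : ∑ i, ∑ j, (κ i * b j) ^ 2 = ∑ i, ∑ j, (κ j * b i) ^ 2 := Finset.sum_comm
  have h2 : ∑ i, ∑ j, (κ i * b i) * (κ j * b j) = (∑ i, κ i * b i) ^ 2 := by
    rw [sq, Finset.sum_mul_sum]
  have h3 : 2 * ∑ i, ∑ j, (1 / 2 * (κ j * b i + κ i * b j)) ^ 2 =
      1 / 2 * ∑ i, ∑ j, (κ j * b i) ^ 2 + 1 / 2 * ∑ i, ∑ j, (κ i * b j) ^ 2 +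
        ∑ i, ∑ j, (κ i * b i) * (κ j * b j) := by
    simp only [Finset.mul_sum, ← Finset.sum_add_distrib]
    refine Finset.sum_congr rfl fun i _ => Finset.sum_congr rfl fun j _ => ?_
    ring
  rw [h3, h1, h2]
  nlinarith [sq_nonneg (∑ i, κ i * b i)]

/-- Korn's inequality for periodic displacements. -/
theorem korn {w : Fin d → Space d → ℝ} {G : Fin d → Fin d → Space d → ℝ}
    (hG : ∀ i j, MemLp (G i j) 2 Q.avg) (h : ∀ i j, Q.IsCellPartial j (w i) (G i j)) :
    ∑ i, ∑ j, ∫ x, G i j x * G i j x ∂Q.avg ≤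
      2 * ∑ i, ∑ j, ∫ x, (1 / 2 * (G i j x + G j i x)) * (1 / 2 * (G i j x + G j i x)) ∂Q.avg := by
  have hS : ∀ i j, MemLp (fun x => 1 / 2 * (G i j x + G j i x)) 2 Q.avg := fun i j =>
    ((hG i j).add (hG j i)).const_mul _
  have hi : ∀ i j, Integrable (G i j) Q.avg := fun i j => (hG i j).integrable (by norm_num)
  -- Parseval's identity on both sides reduces the inequality to one frequency at a time.
  refine hasSum_le ?_ (hasSum_sum fun i _ => hasSum_sum fun j _ =>
      hasSum_coeff_mul (hG i j) (hG i j))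
    ((hasSum_sum fun i _ => hasSum_sum fun j _ => hasSum_coeff_mul (hS i j) (hS i j)).mul_left 2)
  intro k
  simp only [cosCoeff_symm (hi _ _) (hi _ _), sinCoeff_symm (hi _ _) (hi _ _),
    (h _ _).cosCoeff_eq, (h _ _).sinCoeff_eq, Finset.sum_add_distrib, mul_add (2 : ℝ), ← sq]
  -- Differentiation exchanges the coefficients: the cosine part has amplitude `sinCoeff` of `w`,
  -- the sine part `-cosCoeff`.
  refine add_le_add ?_ ?_
  · simpa only [mul_add] using sum_sq_le_two_mul_symm (Q.waveVec k) fun i => Q.sinCoeff k (w i)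
  · simpa only [mul_add, mul_neg] using
      sum_sq_le_two_mul_symm (Q.waveVec k) fun i => -Q.cosCoeff k (w i)

/-- The inequality of Poincaré for periodic functions with zero average. -/
theorem poincare (Q : UnitCell d) : ∃ C : ℝ, 0 ≤ C ∧
    ∀ (w : Space d → ℝ) (G : Fin d → Space d → ℝ), MemLp w 2 Q.avg →
      (∀ j, MemLp (G j) 2 Q.avg) → (∀ j, Q.IsCellPartial j w (G j)) →
      ∫ x, w x ∂Q.avg = 0 →
      ∫ x, w x * w x ∂Q.avg ≤ C * ∑ j, ∫ x, G j x * G j x ∂Q.avg := by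
  obtain ⟨C, hC0, hC⟩ := Q.exists_waveVec_bound
  refine ⟨C, hC0, fun w G hw hG h h0 => ?_⟩
  refine hasSum_le ?_ (hasSum_coeff_mul hw hw)
    ((hasSum_sum fun j _ => hasSum_coeff_mul (hG j) (hG j)).mul_left C)
  intro k
  -- At `k = 0` the zero average of `w` is used; elsewhere, the lower bound on the wave vector.
  by_cases hk : k = 0
  · subst hk
    rw [cosCoeff_zero, sinCoeff_zero, h0]
    simp only [(h _).cosCoeff_eq, (h _).sinCoeff_eq]
    simp
  · simp only [(h _).cosCoeff_eq, (h _).sinCoeff_eq]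
    have h1 := hC k hk
    have h2 : C * ∑ j, (Q.waveVec k j * Q.sinCoeff k w * (Q.waveVec k j * Q.sinCoeff k w) +
        -(Q.waveVec k j * Q.cosCoeff k w) * -(Q.waveVec k j * Q.cosCoeff k w)) =
        (C * ∑ j, Q.waveVec k j ^ 2) *
          (Q.cosCoeff k w * Q.cosCoeff k w + Q.sinCoeff k w * Q.sinCoeff k w) := by
      rw [mul_assoc, Finset.sum_mul]
      congr 1
      refine Finset.sum_congr rfl fun j _ => ?_
      ring
    rw [h2]
    exact le_mul_of_one_le_left (add_nonneg (mul_self_nonneg _) (mul_self_nonneg _)) h1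

/-! ### Periodic displacements with zero average -/

theorem memLp_of_periodic {ψ : Space d → ℝ} (hψ : Continuous ψ)
    (hper : ∀ Z : Q.lattice, ∀ x, ψ (Z + x) = ψ x) : MemLp ψ 2 Q.avg := by
  obtain ⟨C, -, hC⟩ := Q.exists_bound_of_periodic hψ hper
  exact MemLp.of_bound hψ.aestronglyMeasurable C (.of_forall hC)

theorem memLp_periodize {φ : Space d → ℝ} (hφ : Continuous φ) (hc : HasCompactSupport φ) :
    MemLp (Q.periodize φ) 2 Q.avg :=
  memLp_of_periodic (Q.continuous_periodize hc hφ) (Q.periodize_add_mem φ)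

theorem integral_mul_eq_inner {ψ : Space d → ℝ} (hψ : MemLp ψ 2 Q.avg) (f : Lp ℝ 2 Q.avg) :
    ∫ x, f x * ψ x ∂Q.avg = inner ℝ (hψ.toLp ψ) f := by
  rw [L2.inner_def]
  refine integral_congr_ae ?_
  filter_upwards [hψ.coeFn_toLp] with x hx
  simp [hx]

theorem norm_sq_eq_integral (f : Lp ℝ 2 Q.avg) : ‖f‖ ^ 2 = ∫ x, f x * f x ∂Q.avg := by
  rw [← real_inner_self_eq_norm_sq, L2.inner_def]
  simp [sq]

theorem continuous_integral_mul {ψ : Space d → ℝ} (hψ : MemLp ψ 2 Q.avg) :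
    Continuous fun f : Lp ℝ 2 Q.avg => ∫ x, f x * ψ x ∂Q.avg := by
  simp only [integral_mul_eq_inner hψ]
  fun_prop

theorem integral_add_mul {ψ : Space d → ℝ} (hψ : MemLp ψ 2 Q.avg) (f g : Lp ℝ 2 Q.avg) :
    ∫ x, (f + g : Lp ℝ 2 Q.avg) x * ψ x ∂Q.avg =
      ∫ x, f x * ψ x ∂Q.avg + ∫ x, g x * ψ x ∂Q.avg := by
  simp only [integral_mul_eq_inner hψ, inner_add_right]

theorem integral_smul_mul {ψ : Space d → ℝ} (hψ : MemLp ψ 2 Q.avg) (c : ℝ) (f : Lp ℝ 2 Q.avg) :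
    ∫ x, (c • f : Lp ℝ 2 Q.avg) x * ψ x ∂Q.avg = c * ∫ x, f x * ψ x ∂Q.avg := by
  simp only [integral_mul_eq_inner hψ, inner_smul_right]

/-- The periodic displacements of class `H¹` with zero average, with their gradients. -/
def displacements (Q : UnitCell d) :
    Submodule ℝ ((Fin d → Lp ℝ 2 Q.avg) × (Fin d → Fin d → Lp ℝ 2 Q.avg)) where
  -- The factor 1 gives this condition the form of an integral against a fixed function, as in
  -- `continuous_integral_mul`.
  carrier := {p | (∀ i, ∫ x, p.1 i x * 1 ∂Q.avg = 0) ∧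
    ∀ i j, Q.IsCellPartial j (p.1 i) (p.2 i j)}
  add_mem' := by
    rintro p q ⟨hp, hp'⟩ ⟨hq, hq'⟩
    refine ⟨fun i => ?_, fun i j φ hφ => ?_⟩
    · exact (integral_add_mul (memLp_const 1) _ _).trans (by rw [hp, hq, add_zero])
    · have h1 := integral_add_mul (memLp_periodize (Q := Q) (hφ.continuous_pderiv j)
        (hφ.hasCompactSupport_pderiv j)) (p.1 i) (q.1 i)
      have h2 := integral_add_mul (memLp_periodize (Q := Q) hφ.smooth.continuous hφ.compact)
        (p.2 i j) (q.2 i j)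
      refine h1.trans ?_
      rw [hp' i j φ hφ, hq' i j φ hφ, ← neg_add]
      exact congrArg _ h2.symm
  zero_mem' := by
    refine ⟨fun i => ?_, fun i j φ hφ => ?_⟩
    · simp
    · have h1 := integral_smul_mul (memLp_periodize (Q := Q) (hφ.continuous_pderiv j)
        (hφ.hasCompactSupport_pderiv j)) 0 0
      have h2 := integral_smul_mul (memLp_periodize (Q := Q) hφ.smooth.continuous hφ.compact) 0 0
      rw [zero_smul, zero_mul] at h1 h2
      refine h1.trans ?_
      rw [← neg_zero]
      exact congrArg _ h2.symm
  smul_mem' := by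
    rintro c p ⟨hp, hp'⟩
    refine ⟨fun i => ?_, fun i j φ hφ => ?_⟩
    · exact (integral_smul_mul (memLp_const 1) _ _).trans (by rw [hp, mul_zero])
    · have h1 := integral_smul_mul (memLp_periodize (Q := Q) (hφ.continuous_pderiv j)
        (hφ.hasCompactSupport_pderiv j)) c (p.1 i)
      have h2 := integral_smul_mul (memLp_periodize (Q := Q) hφ.smooth.continuous hφ.compact) c
        (p.2 i j)
      refine h1.trans ?_
      rw [hp' i j φ hφ, mul_neg]
      exact congrArg _ h2.symm

theorem isClosed_displacements (Q : UnitCell d) :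
    IsClosed (Q.displacements : Set ((Fin d → Lp ℝ 2 Q.avg) × (Fin d → Fin d → Lp ℝ 2 Q.avg))) := by
  refine IsClosed.and ?_ ?_
  · simp only [Set.ofPred_forall]
    refine isClosed_iInter fun i => ?_
    exact isClosed_eq ((continuous_integral_mul (memLp_const 1)).comp
      ((continuous_apply i).comp continuous_fst)) continuous_const
  · simp only [IsCellPartial, Set.ofPred_forall]
    refine isClosed_iInter fun i => isClosed_iInter fun j => isClosed_iInter fun φ =>
      isClosed_iInter fun hφ => ?_
    exact isClosed_eq ((continuous_integral_mul (memLp_periodize (hφ.continuous_pderiv j)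
      (hφ.hasCompactSupport_pderiv j))).comp ((continuous_apply i).comp continuous_fst))
      ((continuous_integral_mul (memLp_periodize hφ.smooth.continuous hφ.compact)).comp
      ((continuous_apply j).comp ((continuous_apply i).comp continuous_snd))).neg

/-- The symmetrized gradient. -/
def symGrad (Q : UnitCell d) : Q.displacements →L[ℝ] (Fin d → Fin d → Lp ℝ 2 Q.avg) :=
  (ContinuousLinearMap.pi fun i => ContinuousLinearMap.pi fun j =>
    (1 / 2 : ℝ) • ((ContinuousLinearMap.proj (R := ℝ) (φ := fun _ : Fin d => Lp ℝ 2 Q.avg) j ∘L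
        ContinuousLinearMap.proj (R := ℝ) (φ := fun _ : Fin d => Fin d → Lp ℝ 2 Q.avg) i) +
      (ContinuousLinearMap.proj (R := ℝ) (φ := fun _ : Fin d => Lp ℝ 2 Q.avg) i ∘L
        ContinuousLinearMap.proj (R := ℝ) (φ := fun _ : Fin d => Fin d → Lp ℝ 2 Q.avg) j))) ∘L
    ContinuousLinearMap.snd ℝ _ _ ∘L Q.displacements.subtypeL

theorem symGrad_apply (p : Q.displacements) (i j : Fin d) :
    Q.symGrad p i j = (1 / 2 : ℝ) • (p.1.2 i j + p.1.2 j i) := rfl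

theorem coeFn_symGrad (p : Q.displacements) (i j : Fin d) :
    ∀ᵐ x ∂Q.avg, Q.symGrad p i j x = 1 / 2 * (p.1.2 i j x + p.1.2 j i x) := by
  rw [symGrad_apply]
  filter_upwards [Lp.coeFn_smul (1 / 2 : ℝ) (p.1.2 i j + p.1.2 j i),
    Lp.coeFn_add (p.1.2 i j) (p.1.2 j i)] with x h1 h2
  rw [h1, Pi.smul_apply, h2, Pi.add_apply, smul_eq_mul]

/-- Korn's inequality controls the gradient by its symmetric part and Poincaré's controls the
displacement by the gradient. The map is therefore antilipschitz on a complete space. -/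
theorem isClosed_range_symGrad (Q : UnitCell d) : IsClosed (Set.range Q.symGrad) := by
  have : CompleteSpace Q.displacements := Q.isClosed_displacements.completeSpace_coe
  obtain ⟨C, hC0, hC⟩ := Q.poincare
  -- The norms on products are suprema, so summing over the `d²` components costs `d²`; Korn gives
  -- the 2 and Poincaré the `C`. With `D = 2d²(1 + C)`, the squared norms are bounded by `D m²`, and
  -- `D ≤ (D + 1)²` avoids a square root.
  have hbound : ∀ p : Q.displacements, ‖p‖ ≤ (2 * d ^ 2 * (1 + C) + 1) * ‖Q.symGrad p‖ := by
    intro p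
    have hK := korn (Q := Q) (fun i j => Lp.memLp (p.1.2 i j)) p.2.2
    have hS : ∑ i, ∑ j, ∫ x, (1 / 2 * (p.1.2 i j x + p.1.2 j i x)) *
        (1 / 2 * (p.1.2 i j x + p.1.2 j i x)) ∂Q.avg ≤
        d ^ 2 * ‖Q.symGrad p‖ ^ 2 := by
      have h1 : ∀ i j, ∫ x, (1 / 2 * (p.1.2 i j x + p.1.2 j i x)) *
          (1 / 2 * (p.1.2 i j x + p.1.2 j i x)) ∂Q.avg ≤ ‖Q.symGrad p‖ ^ 2 := by
        intro i j
        have h2 : ‖Q.symGrad p i j‖ ≤ ‖Q.symGrad p‖ :=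
          (norm_le_pi_norm _ j).trans (norm_le_pi_norm _ i)
        refine le_trans (le_of_eq ?_) (pow_le_pow_left₀ (norm_nonneg _) h2 2)
        rw [norm_sq_eq_integral]
        refine integral_congr_ae ?_
        filter_upwards [coeFn_symGrad p i j] with x hx
        rw [hx]
      refine (Finset.sum_le_sum fun i _ => Finset.sum_le_sum fun j _ => h1 i j).trans (le_of_eq ?_)
      simp
      ring
    set m := ‖Q.symGrad p‖
    have hm : 0 ≤ m := norm_nonneg _
    set T := ∑ i, ∑ j, ∫ x, p.1.2 i j x * p.1.2 i j x ∂Q.avg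
    have hT : T ≤ 2 * d ^ 2 * m ^ 2 := by linarith
    have hG0 : ∀ i j, 0 ≤ ∫ x, p.1.2 i j x * p.1.2 i j x ∂Q.avg := fun i j =>
      integral_nonneg fun x => mul_self_nonneg _
    have hrow : ∀ i, ∑ j, ∫ x, p.1.2 i j x * p.1.2 i j x ∂Q.avg ≤ T := fun i =>
      Finset.single_le_sum (f := fun i => ∑ j, ∫ x, p.1.2 i j x * p.1.2 i j x ∂Q.avg)
        (fun i _ => Finset.sum_nonneg fun j _ => hG0 i j) (Finset.mem_univ i)
    have hT0 : 0 ≤ T := Finset.sum_nonneg fun i _ => Finset.sum_nonneg fun j _ => hG0 i j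
    have hfin : ∀ f : Lp ℝ 2 Q.avg, ‖f‖ ^ 2 ≤ (1 + C) * T →
        ‖f‖ ≤ (2 * d ^ 2 * (1 + C) + 1) * m := by
      intro f hf
      refine le_of_sq_le_sq ?_ (by positivity)
      have hD : 0 ≤ 2 * (d : ℝ) ^ 2 * (1 + C) := by positivity
      have h1 : (1 + C) * T ≤ 2 * (d : ℝ) ^ 2 * (1 + C) * m ^ 2 := by
        have := mul_le_mul_of_nonneg_left hT (by linarith : 0 ≤ 1 + C)
        linarith
      rw [mul_pow]
      refine (hf.trans h1).trans (mul_le_mul_of_nonneg_right ?_ (sq_nonneg m))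
      nlinarith
    have hK0 : 0 ≤ (2 * (d : ℝ) ^ 2 * (1 + C) + 1) * m := by positivity
    refine max_le ((pi_norm_le_iff_of_nonneg hK0).2 fun i => hfin _ ?_)
      ((pi_norm_le_iff_of_nonneg hK0).2 fun i => (pi_norm_le_iff_of_nonneg hK0).2 fun j =>
        hfin _ ?_)
    · rw [norm_sq_eq_integral]
      have h1 := hC (p.1.1 i) (fun j => p.1.2 i j) (Lp.memLp _)
        (fun j => Lp.memLp _) (fun j => p.2.2 i j) (by simpa using p.2.1 i)
      have h2 := mul_le_mul_of_nonneg_left (hrow i) hC0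
      refine h1.trans ?_
      linarith
    · rw [norm_sq_eq_integral]
      have h1 := (Finset.single_le_sum (f := fun j =>
        ∫ x, p.1.2 i j x * p.1.2 i j x ∂Q.avg) (fun j _ => hG0 i j)
        (Finset.mem_univ j)).trans (hrow i)
      have h2 := mul_nonneg hC0 hT0
      refine h1.trans ?_
      linarith
  have hK : 0 ≤ 2 * (d : ℝ) ^ 2 * (1 + C) + 1 := by positivity
  exact (AddMonoidHomClass.antilipschitz_of_bound Q.symGrad
    (K := ⟨2 * (d : ℝ) ^ 2 * (1 + C) + 1, hK⟩) hbound).isClosed_range Q.symGrad.uniformContinuous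

end UnitCell

variable {Q : UnitCell d} {A B L₀ : ElasticityTensor d}

/-! ### Components of tensor fields -/

/-- The `(i, j)` component, as a linear form. -/
def SymTensor.compL (d : ℕ) (i j : Fin d) : SymTensor d →L[ℝ] ℝ :=
  LinearMap.toContinuousLinearMap
    { toFun := fun e => e.comp i j
      map_add' := fun _ _ => rfl
      map_smul' := fun _ _ => rfl }

theorem SymTensor.compL_apply (i j : Fin d) (e : SymTensor d) :
    SymTensor.compL d i j e = e.comp i j := rfl

theorem SymTensor.comp_symm (e : SymTensor d) (i j : Fin d) : e.comp i j = e.comp j i :=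
  e.2 i j

/-- The `(i, j)` component of a tensor field. -/
def fieldComp (Q : UnitCell d) (A : ElasticityTensor d) (i j : Fin d) :
    Field Q A →L[ℝ] Lp ℝ 2 Q.avg :=
  ((SymTensor.compL d i j) ∘L (Energetic.toSymL A).toContinuousLinearMap).compLpL 2 Q.avg

theorem coeFn_fieldComp (i j : Fin d) (η : Field Q A) :
    ∀ᵐ x ∂Q.avg, fieldComp Q A i j η x = (val η x).comp i j :=
  ((SymTensor.compL d i j) ∘L (Energetic.toSymL A).toContinuousLinearMap).coeFn_compLpL η

theorem memLp_comp (η : Field Q A) (i j : Fin d) :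
    MemLp (fun x => (val η x).comp i j) 2 Q.avg :=
  (Lp.memLp (fieldComp Q A i j η)).ae_eq (coeFn_fieldComp i j η)

theorem integrable_comp_mul_comp (τ : Field Q A) (η : Field Q B) (i j : Fin d) :
    Integrable (fun x => (val τ x).comp i j * (val η x).comp i j) Q.avg :=
  (memLp_comp τ i j).integrable_mul (memLp_comp η i j)

theorem dual_eq_sum (τ : Field Q A) (η : Field Q B) :
    dual τ η = ∑ i, ∑ j, ∫ x, (val τ x).comp i j * (val η x).comp i j ∂Q.avg := by
  simp only [dual, ddot]
  rw [integral_finsetSum _ fun i _ => integrable_finsetSum _ fun j _ =>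
    integrable_comp_mul_comp τ η i j]
  exact Finset.sum_congr rfl fun i _ =>
    integral_finsetSum _ fun j _ => integrable_comp_mul_comp τ η i j

theorem mean_comp (η : Field Q A) (i j : Fin d) :
    (mean η).comp i j = ∫ x, (val η x).comp i j ∂Q.avg := by
  rw [mean, ← SymTensor.compL_apply, ← ContinuousLinearMap.integral_comp_comm _ (integrable_val η)]
  rfl

theorem integrable_ddot (τ : Field Q A) (η : Field Q B) :
    Integrable (fun x => ddot (val τ x) (val η x)) Q.avg :=
  integrable_finsetSum _ fun i _ => integrable_finsetSum _ fun j _ =>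
    integrable_comp_mul_comp τ η i j

theorem ddot_comm (s e : SymTensor d) : ddot s e = ddot e s := by
  rw [← inner_eq_ddot, real_inner_comm, inner_eq_ddot]

theorem ddot_smul_right (c : ℝ) (s e : SymTensor d) : ddot s (c • e) = c * ddot s e := by
  have h : ∀ i j, (c • e).comp i j = c * e.comp i j := fun _ _ => rfl
  simp only [ddot, h, mul_left_comm _ c, Finset.mul_sum]

theorem dual_comm (τ : Field Q A) (η : Field Q B) : dual τ η = dual η τ := by
  simp only [dual, ddot_comm]

theorem dual_add_right (τ : Field Q A) (η η' : Field Q B) :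
    dual τ (η + η') = dual τ η + dual τ η' := by
  rw [dual, dual, dual, ← integral_add (integrable_ddot τ η) (integrable_ddot τ η')]
  refine integral_congr_ae ?_
  filter_upwards [val_add η η'] with x hx
  rw [hx]
  simp only [← inner_eq_ddot, inner_add_right]

theorem dual_smul_right (c : ℝ) (τ : Field Q A) (η : Field Q B) :
    dual τ (c • η) = c * dual τ η := by
  rw [dual, dual, ← integral_const_mul]
  refine integral_congr_ae ?_
  filter_upwards [val_smul c η] with x hx
  rw [hx, ddot_smul_right]

theorem dual_sub_right (τ : Field Q A) (η η' : Field Q B) :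
    dual τ (η - η') = dual τ η - dual τ η' := by
  rw [sub_eq_add_neg, ← neg_one_smul ℝ η', dual_add_right, dual_smul_right]
  ring

theorem dual_add_left (τ τ' : Field Q A) (η : Field Q B) :
    dual (τ + τ') η = dual τ η + dual τ' η := by
  rw [dual_comm, dual_add_right, dual_comm η, dual_comm η]

theorem dual_sub_left (τ τ' : Field Q A) (η : Field Q B) :
    dual (τ - τ') η = dual τ η - dual τ' η := by
  rw [dual_comm, dual_sub_right, dual_comm η, dual_comm η]

theorem dual_uniform (η : Field Q A) (ε : SymTensor d) :
    dual η (uniform Q B ε) = ddot (mean η) ε := by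
  rw [dual_comm, dual]
  have h : ∫ x, ddot (val (uniform Q B ε) x) (val η x) ∂Q.avg
      = ∫ x, inner ℝ ε (val η x) ∂Q.avg := by
    refine integral_congr_ae ?_
    filter_upwards [val_uniform (Q := Q) (A := B) ε] with x hx
    rw [hx, inner_eq_ddot]
  rw [h, integral_inner (integrable_val η), ← inner_eq_ddot, real_inner_comm]
  rfl

theorem mean_uniform (ε : SymTensor d) : mean (uniform Q A ε) = ε := by
  rw [mean, integral_congr_ae (val_uniform ε)]
  simp

theorem mean_add (η η' : Field Q A) : mean (η + η') = mean η + mean η' := by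
  rw [mean, integral_congr_ae (val_add η η'),
    integral_add (integrable_val η) (integrable_val η')]
  rfl

/-! ### The space of compatible fields is closed -/

/-- Removing its average from a displacement does not change its gradient. In the other direction,
functions on the cell are extended by periodicity. -/
theorem mem_compatible_iff (e : StrainField Q L₀) :
    e ∈ compatible Q L₀ ↔ (fun i j => fieldComp Q L₀ i j e) ∈ Set.range Q.symGrad := by
  constructor
  · rintro ⟨w, G, hw, hG, hd, he⟩
    have hc : ∀ i j, Q.IsCellPartial j (w i) (G i j) := fun i j =>
      ((hw i).isWeakPartial_iff (hG i j) j).1 (hd i j)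
    have hw' : ∀ i, MemLp (fun x => w i x - ∫ y, w i y ∂Q.avg) 2 Q.avg := fun i =>
      (hw i).memLp_avg.sub (memLp_const _)
    have hmem : ((fun i => (hw' i).toLp _, fun i j => (hG i j).memLp_avg.toLp _) :
        (Fin d → Lp ℝ 2 Q.avg) × (Fin d → Fin d → Lp ℝ 2 Q.avg)) ∈ Q.displacements := by
      refine ⟨fun i => ?_, fun i j => ?_⟩
      · simp only [mul_one]
        rw [integral_congr_ae (hw' i).coeFn_toLp,
          integral_sub ((hw i).memLp_avg.integrable (by norm_num)) (integrable_const _)]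
        simp
      · have h : Q.IsCellPartial j (fun x => w i x - ∫ y, w i y ∂Q.avg) (G i j) := by
          intro φ hφ
          rw [← hc i j φ hφ]
          have hm := UnitCell.memLp_periodize (Q := Q) (hφ.continuous_pderiv j)
            (hφ.hasCompactSupport_pderiv j)
          have hi : Integrable (fun x => w i x * Q.periodize (pderiv j φ) x) Q.avg :=
            (hw i).memLp_avg.integrable_mul hm
          simp only [sub_mul]
          rw [integral_sub hi
            ((hm.integrable (by norm_num)).const_mul _), integral_const_mul]
          -- The subtracted constant contributes nothing, since the derivative of a periodic
          -- function has zero average.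
          have h0 := UnitCell.integral_pderiv_eq_zero (Q := Q)
            (Q.contDiff_periodize hφ.compact hφ.smooth) (Q.periodize_add_mem φ) j
          simp only [Q.pderiv_periodize hφ] at h0
          rw [h0, mul_zero, sub_zero]
        exact h.congr (hw' i).coeFn_toLp.symm (hG i j).memLp_avg.coeFn_toLp.symm
    refine ⟨⟨_, hmem⟩, ?_⟩
    funext i j
    refine Lp.ext ?_
    filter_upwards [UnitCell.coeFn_symGrad (Q := Q)
      ⟨_, hmem⟩ i j,
      coeFn_fieldComp i j e, he, (hG i j).memLp_avg.coeFn_toLp, (hG j i).memLp_avg.coeFn_toLp]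
      with x h1 h2 h3 h4 h5
    rw [h1, h2, h3 i j]
    simp only [h4, h5]
  · rintro ⟨p, hp⟩
    choose w hw hwe using fun i => UnitCell.exists_periodic_extension (Lp.memLp (p.1.1 i))
    choose G hG hGe using fun i j => UnitCell.exists_periodic_extension (Lp.memLp (p.1.2 i j))
    refine ⟨w, G, hw, hG, fun i j => ?_, ?_⟩
    · exact ((hw i).isWeakPartial_iff (hG i j) j).2 ((p.2.2 i j).congr (hwe i) (hGe i j))
    · simp only [ae_all_iff]
      intro i j
      have h := congrFun (congrFun hp i) j
      filter_upwards [UnitCell.coeFn_symGrad p i j, coeFn_fieldComp i j e, hGe i j, hGe j i]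
        with x h1 h2 h3 h4
      rw [← h2, ← h, h1, h3, h4]

theorem isClosed_compatible (Q : UnitCell d) (L₀ : ElasticityTensor d) :
    IsClosed (compatible Q L₀ : Set (StrainField Q L₀)) := by
  have h : (compatible Q L₀ : Set (StrainField Q L₀)) =
      (fun e i j => fieldComp Q L₀ i j e) ⁻¹' Set.range Q.symGrad := by
    ext e
    exact mem_compatible_iff e
  rw [h]
  exact Q.isClosed_range_symGrad.preimage
    (continuous_pi fun i => continuous_pi fun j => (fieldComp Q L₀ i j).continuous)

/-! ### Admissible stresses are the annihilator of compatible strains -/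

theorem mean_eq_zero_of_mem_compatible {e : StrainField Q L₀} (he : e ∈ compatible Q L₀) :
    mean e = 0 := by
  obtain ⟨w, G, hw, hG, hd, he⟩ := he
  have hG0 : ∀ i j, ∫ x, G i j x ∂Q.avg = 0 := fun i j =>
    (((hw i).isWeakPartial_iff (hG i j) j).1 (hd i j)).integral_eq_zero
  apply Subtype.ext
  ext ⟨i, j⟩
  change (mean e).comp i j = 0
  rw [mean_comp, integral_congr_ae (he.mono fun x hx => hx i j), integral_const_mul,
    integral_add ((hG i j).memLp_avg.integrable (by norm_num))
      ((hG j i).memLp_avg.integrable (by norm_num)), hG0, hG0]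
  simp

theorem dual_uniform_compatible {e : StrainField Q L₀} (he : e ∈ compatible Q L₀)
    (s : SymTensor d) : dual (uniform Q A s) e = 0 := by
  rw [dual_comm, dual_uniform, mean_eq_zero_of_mem_compatible he, ← inner_eq_ddot, inner_zero_left]

/-- Self-equilibrated stresses do no work in compatible strains. -/
theorem dual_eq_zero {s : StressField Q L₀} (hs : s ∈ selfEquilibrated Q L₀)
    {e : StrainField Q L₀} (he : e ∈ compatible Q L₀) : dual s e = 0 := by
  obtain ⟨w, G, hw, hG, hd, he⟩ := he
  obtain ⟨⟨t, ht, hdiv, hst⟩, -⟩ := hs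
  have hsym : ∀ i j, t i j =ᵐ[Q.avg] t j i := by
    intro i j
    filter_upwards [hst] with x hx
    rw [← hx, ← hx, SymTensor.comp_symm]
  have hint : ∀ i j a b, Integrable (fun x => t i j x * G a b x) Q.avg := fun i j a b =>
    (ht i j).memLp_avg.integrable_mul (hG a b).memLp_avg
  -- By the symmetry of the stress, the symmetrized gradient may be replaced by the full one.
  have h1 : dual s e = ∑ i, ∑ j, ∫ x, t i j x * G i j x ∂Q.avg := by
    have h2 : ∀ i j, ∫ x, (val s x).comp i j * (val e x).comp i j ∂Q.avg =
        1 / 2 * ∫ x, t i j x * G i j x ∂Q.avg + 1 / 2 * ∫ x, t j i x * G j i x ∂Q.avg := by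
      intro i j
      rw [← integral_const_mul, ← integral_const_mul,
        ← integral_add ((hint _ _ _ _).const_mul _) ((hint _ _ _ _).const_mul _)]
      refine integral_congr_ae ?_
      filter_upwards [he, hst, hsym i j] with x h3 h4 h5
      rw [h3, h4, ← h5]
      ring
    rw [dual_eq_sum]
    simp only [h2, Finset.sum_add_distrib, ← Finset.mul_sum]
    rw [Finset.sum_comm (f := fun i j => ∫ x, t j i x * G j i x ∂Q.avg)]
    ring
  have hcell : ∀ i j, Q.IsCellPartial j (w i) (G i j) := fun i j =>
    ((hw i).isWeakPartial_iff (hG i j) j).1 (hd i j)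
  have hdiv' : ∀ ψ : Space d → ℝ, ContDiff ℝ ∞ ψ → (∀ Z : Q.lattice, ∀ x, ψ (Z + x) = ψ x) →
      ∀ i, ∑ j, ∫ x, t i j x * pderiv j ψ x ∂Q.avg = 0 := by
    intro ψ hψ hper i
    obtain ⟨φ, hφ, -, h3⟩ := Q.exists_test_periodize_eq hψ hper
    have h4 := UnitCell.IsL2Per.sum_integral_mul_pderiv (ht i) id hφ
    simp only [id] at h4
    rw [hdiv φ hφ i] at h4
    simpa [h3, Q.vol_pos.ne'] using h4.symm
  -- At each frequency, the rows of a divergence-free field are orthogonal to the wave vector, while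
  -- the rows of a gradient are parallel to it.
  have hcos : ∀ k i, ∑ j, Q.waveVec k j * Q.cosCoeff k (t i j) = 0 := by
    intro k i
    have h3 := hdiv' _ (UnitCell.contDiff_sinWave k) (UnitCell.sinWave_periodic k) i
    simpa only [UnitCell.pderiv_sinWave, mul_left_comm (t i _ _), integral_const_mul,
      UnitCell.cosCoeff] using h3
  have hsin : ∀ k i, ∑ j, Q.waveVec k j * Q.sinCoeff k (t i j) = 0 := by
    intro k i
    have h3 := hdiv' _ (UnitCell.contDiff_cosWave k) (UnitCell.cosWave_periodic k) i
    simp only [UnitCell.pderiv_cosWave, mul_left_comm (t i _ _), integral_const_mul] at h3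
    simpa only [neg_mul, Finset.sum_neg_distrib, neg_eq_zero, UnitCell.sinCoeff] using h3
  have hsum := hasSum_sum (s := Finset.univ) fun i _ => hasSum_sum (s := Finset.univ) fun j _ =>
    UnitCell.hasSum_coeff_mul (ht i j).memLp_avg (hG i j).memLp_avg
  rw [h1]
  refine hsum.unique ?_
  convert hasSum_zero with k
  refine Finset.sum_eq_zero fun i _ => ?_
  simp only [(hcell _ _).cosCoeff_eq, (hcell _ _).sinCoeff_eq]
  calc ∑ j, (Q.cosCoeff k (t i j) * (Q.waveVec k j * Q.sinCoeff k (w i)) +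
        Q.sinCoeff k (t i j) * -(Q.waveVec k j * Q.cosCoeff k (w i)))
      = (∑ j, Q.waveVec k j * Q.cosCoeff k (t i j)) * Q.sinCoeff k (w i) -
        (∑ j, Q.waveVec k j * Q.sinCoeff k (t i j)) * Q.cosCoeff k (w i) := by
        rw [Finset.sum_mul, Finset.sum_mul, ← Finset.sum_sub_distrib]
        refine Finset.sum_congr rfl fun j _ => ?_
        ring
    _ = 0 := by rw [hcos, hsin]; ring

/-- The symmetric tensor `(e_i ⊗ e_j + e_j ⊗ e_i) / 2`. -/
def symUnit (i j : Fin d) : SymTensor d :=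
  ⟨WithLp.toLp 2 fun p => 1 / 2 * ((if p.1 = i ∧ p.2 = j then 1 else 0) +
    (if p.2 = i ∧ p.1 = j then 1 else 0)), fun a b => by simp [add_comm]⟩

theorem symUnit_comp (i j a b : Fin d) : (symUnit i j).comp a b =
    1 / 2 * ((if a = i ∧ b = j then 1 else 0) + (if b = i ∧ a = j then 1 else 0)) := rfl

theorem ddot_symUnit (s : SymTensor d) (i j : Fin d) : ddot s (symUnit i j) = s.comp i j := by
  have h1 : ∑ a, ∑ b, s.comp a b * (if a = i ∧ b = j then 1 else 0) = s.comp i j := by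
    simp [ite_and, Finset.sum_ite_irrel]
  have h2 : ∑ a, ∑ b, s.comp a b * (if b = i ∧ a = j then 1 else 0) = s.comp i j := by
    rw [Finset.sum_comm]
    simp only [s.comp_symm _ _]
    rw [← h1]
  simp only [ddot, symUnit_comp]
  calc ∑ a, ∑ b, s.comp a b * (1 / 2 * ((if a = i ∧ b = j then 1 else 0) +
        (if b = i ∧ a = j then 1 else 0)))
      = 1 / 2 * ∑ a, ∑ b, s.comp a b * (if a = i ∧ b = j then 1 else 0) +
        1 / 2 * ∑ a, ∑ b, s.comp a b * (if b = i ∧ a = j then 1 else 0) := by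
        simp only [Finset.mul_sum, ← Finset.sum_add_distrib]
        refine Finset.sum_congr rfl fun a _ => Finset.sum_congr rfl fun b _ => ?_
        ring
    _ = _ := by rw [h1, h2]; ring

/-- The periodized displacement `φ e_i` has a compatible symmetrized gradient. -/
theorem exists_compatible_of_test (Q : UnitCell d) (L₀ : ElasticityTensor d) {φ : Space d → ℝ}
    (hφ : IsTest φ) (i : Fin d) : ∃ e ∈ compatible Q L₀, ∀ᵐ x ∂Q.avg,
      val e x = ∑ j, Q.periodize (pderiv j φ) x • symUnit i j := by
  classical
  let ψ := Q.periodize φ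
  have hψ : ContDiff ℝ ∞ ψ := Q.contDiff_periodize hφ.compact hφ.smooth
  have hc : ∀ j, Continuous (pderiv j ψ) := fun j =>
    (hψ.continuous_fderiv (by simp)).clm_apply continuous_const
  have hp : ∀ j, pderiv j ψ = Q.periodize (pderiv j φ) := fun j =>
    funext (Q.pderiv_periodize hφ j)
  have hL2 : ∀ u : Space d → ℝ, Continuous u → (∀ Z : Q.lattice, ∀ x, u (Z + x) = u x) →
      Q.IsL2Per u := fun u hu hper =>
    UnitCell.isL2Per_of_memLp hu.aestronglyMeasurable hper (UnitCell.memLp_of_periodic hu hper)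
  have hmem : MemLp (fun x => ∑ j, (Energetic.toSym L₀).symm (pderiv j ψ x • symUnit i j)) 2
      Q.avg := by
    refine memLp_finsetSum _ fun j _ => ?_
    have h1 : MemLp (pderiv j ψ) 2 Q.avg := by
      rw [hp]
      exact UnitCell.memLp_periodize (hφ.continuous_pderiv j) (hφ.hasCompactSupport_pderiv j)
    exact (((Energetic.toSymL L₀).symm.toContinuousLinearMap ∘L
      (ContinuousLinearMap.toSpanSingleton ℝ (symUnit i j))).comp_memLp' h1)
  have hval : ∀ᵐ x ∂Q.avg, val (hmem.toLp _) x = ∑ j, pderiv j ψ x • symUnit i j := by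
    filter_upwards [hmem.coeFn_toLp] with x hx
    rw [val, hx, map_sum]
    simp
  -- The displacement is `ψ e_i`, with gradient components `δ_{ai} ∂ψ/∂x_b`.
  refine ⟨hmem.toLp _, ⟨fun a x => (if a = i then 1 else 0) * ψ x,
    fun a b x => (if a = i then 1 else 0) * pderiv b ψ x, fun a => ?_, fun a b => ?_,
    fun a b θ hθ => ?_, ?_⟩, ?_⟩
  · exact (hL2 ψ hψ.continuous (Q.periodize_add_mem φ)).smul _
  · refine (hL2 _ (hc b) ?_).smul _
    rw [hp]
    exact Q.periodize_add_mem _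
  · simp only [mul_assoc, integral_const_mul]
    rw [hθ.integral_mul_pderiv hψ]
    ring
  · filter_upwards [hval] with x hx a b
    rw [hx, ← SymTensor.compL_apply, map_sum]
    simp only [map_smul, SymTensor.compL_apply, symUnit_comp, smul_eq_mul]
    have h1 : ∀ a b, ∑ j, pderiv j ψ x * (if a = i ∧ b = j then (1 : ℝ) else 0) =
        (if a = i then 1 else 0) * pderiv b ψ x := by
      intro a b
      by_cases h : a = i <;> simp [h]
    rw [← h1 a b, ← h1 b a, ← Finset.sum_add_distrib, Finset.mul_sum]
    refine Finset.sum_congr rfl fun j _ => ?_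
    ring
  · simpa only [hp] using hval

/-- Uniform stresses do no work because compatible strains have zero average. Conversely, vanishing
work in the strains of the periodized displacements `φ e_i` is the weak equilibrium equation. -/
theorem mem_admissibleStresses_iff (s : StressField Q L₀) :
    s ∈ admissibleStresses Q L₀ ↔ ∀ e ∈ compatible Q L₀, dual s e = 0 := by
  constructor
  · intro hs e he
    obtain ⟨_, ⟨a, rfl⟩, s₀, hs₀, rfl⟩ := Submodule.mem_sup.1 hs
    rw [dual_add_left, dual_uniform_compatible he, dual_eq_zero hs₀ he, add_zero]
  · intro h
    -- The uniform part carries the average, so `s - m` can lie in `S₀`; it also annihilates `E₀`,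
    -- so the hypothesis passes to `s - m`.
    set m := uniform Q L₀.inv (mean s)
    have hsplit : s = m + (s - m) := by abel
    have h0 : ∀ e ∈ compatible Q L₀, dual (s - m) e = 0 := by
      intro e he
      rw [dual_sub_left, h e he, dual_uniform_compatible he, sub_zero]
    rw [hsplit]
    refine Submodule.add_mem_sup ⟨mean s, rfl⟩ ⟨?_, ?_⟩
    · choose t ht hte using fun i j =>
        UnitCell.exists_periodic_extension (memLp_comp (s - m) i j)
      refine ⟨t, ht, fun φ hφ i => ?_, ?_⟩
      · obtain ⟨e, he, hval⟩ := exists_compatible_of_test Q L₀ hφ i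
        have h1 := UnitCell.IsL2Per.sum_integral_mul_pderiv (ht i) id hφ
        simp only [id] at h1
        rw [h1, ← mul_zero Q.vol, ← h0 e he, dual, ← integral_finsetSum]
        · congr 1
          refine integral_congr_ae ?_
          filter_upwards [hval, ae_all_iff.2 (hte i)] with x h2 h3
          rw [h2, ← inner_eq_ddot, inner_sum]
          refine Finset.sum_congr rfl fun j _ => ?_
          rw [inner_eq_ddot, ddot_smul_right, ddot_symUnit, h3 j, mul_comm]
        · exact fun j _ => (ht i j).memLp_avg.integrable_mul
            (UnitCell.memLp_periodize (hφ.continuous_pderiv j) (hφ.hasCompactSupport_pderiv j))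
      · simp only [ae_all_iff]
        exact hte
    · have h1 := mean_add m (s - m)
      rw [← hsplit, mean_uniform] at h1
      simpa using h1

/-! ### The isometry between strains and stresses -/

/-- The isometry `η ↦ L₀ η` from strain fields to stress fields. -/
def toStress (Q : UnitCell d) (L₀ : ElasticityTensor d) :
    StrainField Q L₀ →L[ℝ] StressField Q L₀ :=
  ((Energetic.toSymL L₀.inv).symm.toContinuousLinearMap ∘L L₀.op.toContinuousLinearMap ∘L
    (Energetic.toSymL L₀).toContinuousLinearMap).compLpL 2 Q.avg

/-- The inverse isometry `τ ↦ L₀⁻¹ τ` from stress fields to strain fields. -/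
def toStrain (Q : UnitCell d) (L₀ : ElasticityTensor d) :
    StressField Q L₀ →L[ℝ] StrainField Q L₀ :=
  ((Energetic.toSymL L₀).symm.toContinuousLinearMap ∘L L₀.inv.op.toContinuousLinearMap ∘L
    (Energetic.toSymL L₀.inv).toContinuousLinearMap).compLpL 2 Q.avg

theorem val_toStress (η : StrainField Q L₀) :
    ∀ᵐ x ∂Q.avg, val (toStress Q L₀ η) x = L₀.op (val η x) := by
  filter_upwards [((Energetic.toSymL L₀.inv).symm.toContinuousLinearMap ∘L
    L₀.op.toContinuousLinearMap ∘L
    (Energetic.toSymL L₀).toContinuousLinearMap).coeFn_compLpL η] with x hx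
  rw [val, toStress, hx]
  rfl

theorem val_toStrain (τ : StressField Q L₀) :
    ∀ᵐ x ∂Q.avg, val (toStrain Q L₀ τ) x = L₀.inv.op (val τ x) := by
  filter_upwards [((Energetic.toSymL L₀).symm.toContinuousLinearMap ∘L
    L₀.inv.op.toContinuousLinearMap ∘L
    (Energetic.toSymL L₀.inv).toContinuousLinearMap).coeFn_compLpL τ] with x hx
  rw [val, toStrain, hx]
  rfl

theorem ElasticityTensor.inv_op (A : ElasticityTensor d) (e : SymTensor d) :
    A.inv.op (A.op e) = e :=
  A.equiv.symm_apply_apply e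

theorem field_ext {η η' : Field Q A} (h : ∀ᵐ x ∂Q.avg, val η x = val η' x) : η = η' :=
  Lp.ext (h.mono fun _ hx => (Energetic.toSym A).injective hx)

@[simp]
theorem toStress_toStrain (τ : StressField Q L₀) : toStress Q L₀ (toStrain Q L₀ τ) = τ := by
  refine field_ext ?_
  filter_upwards [val_toStress (toStrain Q L₀ τ), val_toStrain τ] with x h1 h2
  rw [h1, h2, ElasticityTensor.op_inv]

@[simp]
theorem toStrain_toStress (η : StrainField Q L₀) : toStrain Q L₀ (toStress Q L₀ η) = η := by
  refine field_ext ?_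
  filter_upwards [val_toStrain (toStress Q L₀ η), val_toStress η] with x h1 h2
  rw [h1, h2, ElasticityTensor.inv_op]

theorem inner_strain (η η' : StrainField Q L₀) : inner ℝ η η' = dual (toStress Q L₀ η) η' := by
  rw [inner_eq_average, dual]
  refine integral_congr_ae ?_
  filter_upwards [val_toStress η] with x hx
  rw [hx]

theorem inner_stress (τ τ' : StressField Q L₀) : inner ℝ τ τ' = dual (toStrain Q L₀ τ) τ' := by
  rw [inner_eq_average, dual]
  refine integral_congr_ae ?_
  filter_upwards [val_toStrain τ] with x hx
  rw [hx]

/-- The factors `L₀` and `L₀⁻¹` cancel. Annihilators for `dual` thereby become orthogonal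
complements, up to the isometry. -/
theorem inner_toStress (η : StrainField Q L₀) (τ : StressField Q L₀) :
    inner ℝ (toStress Q L₀ η) τ = dual η τ := by
  rw [inner_stress, toStrain_toStress]

theorem inner_toStrain (τ : StressField Q L₀) (η : StrainField Q L₀) :
    inner ℝ (toStrain Q L₀ τ) η = dual τ η := by
  rw [inner_strain, toStress_toStrain]

theorem norm_sq_toStress (η : StrainField Q L₀) : ‖toStress Q L₀ η‖ ^ 2 = ‖η‖ ^ 2 := by
  rw [← real_inner_self_eq_norm_sq, ← real_inner_self_eq_norm_sq, inner_toStress, inner_strain,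
    dual_comm]

theorem norm_sq_toStrain (τ : StressField Q L₀) : ‖toStrain Q L₀ τ‖ ^ 2 = ‖τ‖ ^ 2 := by
  rw [← norm_sq_toStress, toStress_toStrain]

/-- An annihilator is an intersection of kernels of continuous forms. Closedness provides the
projector onto `S` from which the gradient of `J_c` is built. -/
theorem isClosed_admissibleStresses (Q : UnitCell d) (L₀ : ElasticityTensor d) :
    IsClosed (admissibleStresses Q L₀ : Set (StressField Q L₀)) := by
  have h : (admissibleStresses Q L₀ : Set (StressField Q L₀)) =
      ⋂ e ∈ compatible Q L₀, {s | dual e s = 0} := by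
    ext s
    simp only [SetLike.mem_coe, mem_admissibleStresses_iff, Set.mem_iInter, Set.mem_ofPred_eq,
      dual_comm s]
  rw [h]
  refine isClosed_biInter fun e _ => ?_
  simp only [← inner_toStress]
  exact isClosed_eq (by fun_prop) continuous_const

/-! ### Gradients of quadratic functionals -/

/-- The difference quotient of such a quadratic expansion is `l h + t * q h`, which tends to `l h`.
-/
theorem isGradientOn_iff {H : Type*} [NormedAddCommGroup H] [InnerProductSpace ℝ H]
    {K : Submodule ℝ H} {F l q : H → ℝ} {x g : H}
    (hF : ∀ h ∈ K, ∀ t : ℝ, F (x + t • h) = F x + t * l h + t ^ 2 * q h) :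
    IsGradientOn K F x g ↔ x ∈ K ∧ g ∈ K ∧ ∀ h ∈ K, inner ℝ g h = l h := by
  refine and_congr_right fun _ => and_congr_right fun _ => forall₂_congr fun h hh => ?_
  have hl : Tendsto (fun t : ℝ => (F (x + t • h) - F x) / t) (𝓝[≠] 0) (𝓝 (l h)) := by
    have h1 : Tendsto (fun t : ℝ => l h + t * q h) (𝓝[≠] 0) (𝓝 (l h)) := by
      have h2 : Continuous fun t : ℝ => l h + t * q h := by fun_prop
      simpa using (h2.tendsto 0).mono_left nhdsWithin_le_nhds
    refine h1.congr' ?_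
    filter_upwards [self_mem_nhdsWithin] with t ht
    have ht' : t ≠ 0 := ht
    rw [hF h hh t]
    field_simp
    ring
  exact ⟨fun h' => tendsto_nhds_unique h' hl, fun h' => h' ▸ hl⟩

/-- The derivative is represented on `K` by a vector `z` of the whole space, so the gradient is the
projection of `z` onto `K`. -/
theorem existsUnique_isGradientOn {H : Type*} [NormedAddCommGroup H] [InnerProductSpace ℝ H]
    {K : Submodule ℝ H} [K.HasOrthogonalProjection] {F l q : H → ℝ} {x z : H} (hx : x ∈ K)
    (hF : ∀ h ∈ K, ∀ t : ℝ, F (x + t • h) = F x + t * l h + t ^ 2 * q h)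
    (hz : ∀ h ∈ K, inner ℝ z h = l h) : ∃! g, IsGradientOn K F x g := by
  simp only [isGradientOn_iff hF]
  refine ⟨K.starProjection z, ⟨hx, K.starProjection_apply_mem z, fun h hh => ?_⟩, ?_⟩
  · rw [← hz h hh, ← sub_eq_zero, ← inner_sub_left, ← neg_sub, inner_neg_left,
      K.starProjection_inner_eq_zero z h hh, neg_zero]
  · rintro g ⟨-, hg, hgl⟩
    refine (K.eq_starProjection_of_mem_of_inner_eq_zero hg fun h hh => ?_).symm
    rw [inner_sub_left, hz h hh, hgl h hh, sub_self]

/-! ### The energies -/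

namespace StiffnessField

theorem mul_add (L : StiffnessField Q) (η η' : Field Q A) :
    L.mul B (η + η') = L.mul B η + L.mul B η' := by
  refine field_ext ?_
  filter_upwards [L.val_mul B (η + η'), L.val_mul B η, L.val_mul B η',
    val_add (L.mul B η) (L.mul B η'), val_add η η'] with x h1 h2 h3 h4 h5
  rw [h1, h4, h2, h3, h5, map_add]

theorem mul_smul (L : StiffnessField Q) (c : ℝ) (η : Field Q A) :
    L.mul B (c • η) = c • L.mul B η := by
  refine field_ext ?_
  filter_upwards [L.val_mul B (c • η), L.val_mul B η, val_smul c (L.mul B η), val_smul c η]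
    with x h1 h2 h3 h4
  rw [h1, h3, h2, h4, map_smul]

theorem dual_mul_symm (L : StiffnessField Q) (η η' : Field Q A) :
    dual (L.mul B η) η' = dual (L.mul B η') η := by
  refine integral_congr_ae ?_
  filter_upwards [L.val_mul B η, L.val_mul B η'] with x h1 h2
  rw [h1, h2, ElasticityTensor.major_symm, ddot_comm]

theorem dual_mul_add_smul (L : StiffnessField Q) (η h : Field Q A) (t : ℝ) :
    dual (L.mul B (η + t • h)) (η + t • h) =
      dual (L.mul B η) η + 2 * t * dual (L.mul B η) h + t ^ 2 * dual (L.mul B h) h := by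
  rw [mul_add, mul_smul, dual_add_left, dual_add_right, dual_add_right, dual_smul_right,
    dual_smul_right, ← mul_smul, L.dual_mul_symm (t • h) η, dual_smul_right, mul_smul,
    dual_comm (t • _) h, dual_smul_right, dual_comm h]
  ring

end StiffnessField

theorem strainOf_stressOf (L : StiffnessField Q) (η : StrainField Q L₀) :
    strainOf L (stressOf L η) = η := by
  refine field_ext ?_
  filter_upwards [L.inv.val_mul L₀ (stressOf L η), L.val_mul L₀.inv η] with x h1 h2
  rw [strainOf, h1, stressOf, h2]
  exact ElasticityTensor.inv_op _ _

theorem stressOf_strainOf (L : StiffnessField Q) (τ : StressField Q L₀) :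
    stressOf L (strainOf L τ) = τ := by
  refine field_ext ?_
  filter_upwards [L.inv.val_mul L₀ τ, L.val_mul L₀.inv (strainOf L τ)] with x h1 h2
  rw [stressOf, h2, strainOf, h1]
  exact ElasticityTensor.op_inv _ _

theorem meanConstError_eq (L : StiffnessField Q) (τ : StressField Q L₀) (η : StrainField Q L₀) :
    meanConstError L τ η =
      1 / 2 * dual (stressOf L η) η + 1 / 2 * dual τ (strainOf L τ) - dual τ η := by
  have h1 := (integrable_ddot (stressOf L η) η).const_mul (1 / 2)
  have h2 := (integrable_ddot τ (strainOf L τ)).const_mul (1 / 2)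
  have h3 : Integrable (fun x => 1 / 2 * ddot (val (stressOf L η) x) (val η x) +
      1 / 2 * ddot (val τ x) (val (strainOf L τ) x)) Q.avg := h1.add h2
  rw [dual, dual, dual, ← integral_const_mul, ← integral_const_mul, ← integral_add h1 h2,
    ← integral_sub h3 (integrable_ddot _ _)]
  refine integral_congr_ae ?_
  filter_upwards [L.val_mul L₀.inv η, L.inv.val_mul L₀ τ] with x h1 h2
  rw [stressOf, h1, strainOf, h2]
  rfl

theorem strainEnergy_expansion (L : StiffnessField Q) (ε : SymTensor d) (e h : StrainField Q L₀)
    (t : ℝ) : strainEnergy L ε (e - uniform Q L₀ ε + t • h) =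
      strainEnergy L ε (e - uniform Q L₀ ε) + t * dual (stressOf L e) h +
        t ^ 2 * (1 / 2 * dual (stressOf L h) h) := by
  have h1 : uniform Q L₀ ε + (e - uniform Q L₀ ε + t • h) = e + t • h := by abel
  have h2 : uniform Q L₀ ε + (e - uniform Q L₀ ε) = e := by abel
  rw [strainEnergy, strainEnergy, h1, h2]
  simp only [stressOf, StiffnessField.dual_mul_add_smul]
  ring

theorem complEnergy_expansion (L : StiffnessField Q) (ε : SymTensor d) (s h : StressField Q L₀)
    (t : ℝ) : complEnergy L ε (s + t • h) =
      complEnergy L ε s + t * dual (strainOf L s - uniform Q L₀ ε) h +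
        t ^ 2 * (1 / 2 * dual (strainOf L h) h) := by
  have h1 : ∀ τ : StressField Q L₀, ddot (mean τ) ε = dual (uniform Q L₀ ε) τ := fun τ => by
    rw [dual_comm, dual_uniform]
  rw [complEnergy, complEnergy, h1, h1, dual_comm s, dual_comm (s + t • h), strainOf,
    StiffnessField.dual_mul_add_smul, dual_add_right, dual_smul_right, dual_sub_left]
  simp only [strainOf]
  ring

/-! ### The geometric functional -/

theorem equilError_eq_zero {s : StressField Q L₀} (hs : s ∈ admissibleStresses Q L₀) :
    equilError s = 0 := by
  have h : projStressOrth Q L₀ s = 0 :=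
    Submodule.eq_starProjection_of_mem_of_inner_eq_zero (Submodule.zero_mem _) fun y hy => by
      rw [sub_zero]
      exact hy s hs
  rw [equilError, h]
  simp

/-- Since `E₀` is closed, the closure in the definition of the projector can be dropped. -/
theorem projCompatible_eq {e u : StrainField Q L₀} (hu : u ∈ compatible Q L₀)
    (h : ∀ y ∈ compatible Q L₀, inner ℝ (e - u) y = 0) : projCompatible Q L₀ e = u := by
  have hcl : (compatible Q L₀).topologicalClosure = compatible Q L₀ :=
    (isClosed_compatible Q L₀).submodule_topologicalClosure_eq
  refine Submodule.eq_starProjection_of_mem_of_inner_eq_zero ?_ fun y hy => ?_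
  · rwa [hcl]
  · rw [hcl] at hy
    exact h y hy

/-- As `L₀` is constant, `L₀ ε` is again uniform, and uniform stresses annihilate `E₀`. -/
theorem inner_uniform_compatible {e : StrainField Q L₀} (he : e ∈ compatible Q L₀)
    (ε : SymTensor d) : inner ℝ (uniform Q L₀ ε) e = 0 := by
  have h : toStress Q L₀ (uniform Q L₀ ε) = uniform Q L₀.inv (L₀.op ε) := by
    refine field_ext ?_
    filter_upwards [val_toStress (uniform Q L₀ ε), val_uniform (Q := Q) (A := L₀) ε,
      val_uniform (Q := Q) (A := L₀.inv) (L₀.op ε)] with x h1 h2 h3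
    rw [h1, h2, h3]
  rw [inner_strain, h, dual_uniform_compatible he]

theorem sub_uniform_mem_compatible {e : StrainField Q L₀} (he : e ∈ admissibleStrains Q L₀) :
    e - uniform Q L₀ (mean e) ∈ compatible Q L₀ := by
  obtain ⟨_, ⟨a, rfl⟩, e₀, he₀, rfl⟩ := Submodule.mem_sup.1 he
  rw [mean_add, mean_uniform, mean_eq_zero_of_mem_compatible he₀, add_zero, add_sub_cancel_left]
  exact he₀

theorem compatError_eq_zero {e : StrainField Q L₀} {ε : SymTensor d}
    (he : e - uniform Q L₀ ε ∈ compatible Q L₀) : compatError ε e = 0 := by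
  have h : projCompatible Q L₀ e = e - uniform Q L₀ ε := by
    refine projCompatible_eq he fun y hy => ?_
    rw [sub_sub_cancel, inner_uniform_compatible hy]
  rw [compatError, h]
  simp

theorem isGradientOn_strainEnergy_iff (L : StiffnessField Q) (ε : SymTensor d)
    (e g : StrainField Q L₀) :
    IsGradientOn (compatible Q L₀) (strainEnergy L ε) (e - uniform Q L₀ ε) g ↔
      e - uniform Q L₀ ε ∈ compatible Q L₀ ∧ g ∈ compatible Q L₀ ∧
        ∀ h ∈ compatible Q L₀, inner ℝ g h = dual (stressOf L e) h :=
  isGradientOn_iff fun h _ t => strainEnergy_expansion L ε e h t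

theorem isGradientOn_complEnergy_iff (L : StiffnessField Q) (ε : SymTensor d)
    (s g : StressField Q L₀) :
    IsGradientOn (admissibleStresses Q L₀) (complEnergy L ε) s g ↔
      s ∈ admissibleStresses Q L₀ ∧ g ∈ admissibleStresses Q L₀ ∧
        ∀ h ∈ admissibleStresses Q L₀, inner ℝ g h = dual (strainOf L s - uniform Q L₀ ε) h :=
  isGradientOn_iff fun h _ t => complEnergy_expansion L ε s h t

/-- The projection of `Le` onto `S^⊥` is `L₀ g`: since `g ∈ E₀`, `L₀ g` is orthogonal to `S`, and
the equation of the gradient says that `Le - L₀ g` annihilates `E₀`, hence lies in `S`. -/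
theorem equilError_stressOf {L : StiffnessField Q} {ε : SymTensor d} {e g : StrainField Q L₀}
    (hg : IsGradientOn (compatible Q L₀) (strainEnergy L ε) (e - uniform Q L₀ ε) g) :
    equilError (stressOf L e) = 1 / 2 * ‖g‖ ^ 2 := by
  obtain ⟨-, hgK, hgl⟩ := (isGradientOn_strainEnergy_iff L ε e g).1 hg
  have h : projStressOrth Q L₀ (stressOf L e) = toStress Q L₀ g := by
    refine Submodule.eq_starProjection_of_mem_of_inner_eq_zero ?_ fun y hy => ?_
    · rw [Submodule.mem_orthogonal']
      intro s hs
      rw [inner_toStress, dual_comm]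
      exact (mem_admissibleStresses_iff s).1 hs g hgK
    · refine hy _ ((mem_admissibleStresses_iff _).2 fun h hh => ?_)
      rw [dual_sub_left, ← inner_strain, hgl h hh, sub_self]
  rw [equilError, h, norm_sq_toStress]

/-- In `L⁻¹s = (L⁻¹s - ε - L₀⁻¹g) + (ε + L₀⁻¹g)` the second part is orthogonal to `E₀` and the first
lies in `E₀`, so the error is half the squared norm of `L₀⁻¹ g`. -/
theorem compatError_strainOf {L : StiffnessField Q} {ε : SymTensor d} {s g : StressField Q L₀}
    (hg : IsGradientOn (admissibleStresses Q L₀) (complEnergy L ε) s g) :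
    compatError ε (strainOf L s) = 1 / 2 * ‖g‖ ^ 2 := by
  obtain ⟨-, hgK, hgl⟩ := (isGradientOn_complEnergy_iff L ε s g).1 hg
  have horth : ∀ y ∈ compatible Q L₀, inner ℝ (toStrain Q L₀ g) y = 0 := fun y hy => by
    rw [inner_toStrain]
    exact (mem_admissibleStresses_iff g).1 hgK y hy
  have hcl : (compatible Q L₀)ᗮᗮ = compatible Q L₀ := by
    rw [Submodule.orthogonal_orthogonal_eq_closure]
    exact (isClosed_compatible Q L₀).submodule_topologicalClosure_eq
  have h : projCompatible Q L₀ (strainOf L s) =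
      strainOf L s - uniform Q L₀ ε - toStrain Q L₀ g := by
    refine projCompatible_eq ?_ fun y hy => ?_
    -- Membership in `E₀` is tested against each `y` orthogonal to `E₀`. For such `y` the stress `L₀
    -- y` belongs to `S`, so it is an allowed direction in the equation of the gradient.
    · rw [← hcl, Submodule.mem_orthogonal]
      intro y hy
      have hTy : toStress Q L₀ y ∈ admissibleStresses Q L₀ := by
        rw [mem_admissibleStresses_iff]
        intro u hu
        rw [← inner_strain, real_inner_comm]
        exact hy u hu
      have h1 := hgl _ hTy
      rw [inner_sub_right, inner_strain y (strainOf L s - _), dual_comm, ← h1,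
        real_inner_comm _ g, inner_toStress, real_inner_comm _ y, inner_toStrain, dual_comm,
        sub_self]
    · rw [sub_sub, sub_sub_cancel, inner_add_left, inner_uniform_compatible hy, horth y hy,
        add_zero]
  rw [compatError, h, ← norm_sq_toStrain]
  congr 3
  abel
end Composite

end

/-! ### The proposition. -/

theorem proposition3p4 {d : ℕ} (Q : Composite.UnitCell d) (L₀ : Composite.ElasticityTensor d)
    (L : Composite.StiffnessField Q) (ε : Composite.SymTensor d)
    (e : Composite.StrainField Q L₀) (s : Composite.StressField Q L₀)
    (he : e ∈ Composite.admissibleStrains Q L₀) (hmean : Composite.mean e = ε)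
    (hs : s ∈ Composite.admissibleStresses Q L₀) :
    IsClosed (Composite.compatible Q L₀ : Set (Composite.StrainField Q L₀)) ∧
    (∃! g, Composite.IsGradientOn (Composite.compatible Q L₀) (Composite.strainEnergy L ε)
      (e - Composite.uniform Q L₀ ε) g) ∧
    (∃! g, Composite.IsGradientOn (Composite.admissibleStresses Q L₀)
      (Composite.complEnergy L ε) s g) ∧
    ∀ gJ gJc,
      Composite.IsGradientOn (Composite.compatible Q L₀) (Composite.strainEnergy L ε)
        (e - Composite.uniform Q L₀ ε) gJ →
      Composite.IsGradientOn (Composite.admissibleStresses Q L₀)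
        (Composite.complEnergy L ε) s gJc →
      Composite.geomFunctional L ε s e = Composite.meanConstError L s e ∧
      Composite.geomFunctional L ε (Composite.stressOf L e) e = (1 / 2) * ‖gJ‖ ^ 2 ∧
      Composite.geomFunctional L ε s (Composite.strainOf L s) = (1 / 2) * ‖gJc‖ ^ 2 ∧
      Composite.geomFunctional L ε (Composite.stressOf L e) (Composite.strainOf L s) =
        (1 / 2) * ‖gJc‖ ^ 2 + Composite.meanConstError L s e + (1 / 2) * ‖gJ‖ ^ 2 := by
  open Composite in
  have he' : e - uniform Q L₀ ε ∈ compatible Q L₀ := hmean ▸ sub_uniform_mem_compatible he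
  have hclE := isClosed_compatible Q L₀
  have : CompleteSpace (compatible Q L₀) := hclE.completeSpace_coe
  have : CompleteSpace (admissibleStresses Q L₀) :=
    (isClosed_admissibleStresses Q L₀).completeSpace_coe
  -- The major symmetry of `L` moves it from `e` onto `L⁻¹s`.
  have hcross : dual (stressOf L e) (strainOf L s) = dual s e := by
    rw [stressOf, L.dual_mul_symm]
    exact congrArg (dual · e) (stressOf_strainOf L s)
  refine ⟨hclE, ?_, ?_, fun gJ gJc hJ hJc => ⟨?_, ?_, ?_, ?_⟩⟩
  -- The representing vectors are `L₀⁻¹(Le)` for `J` and `L₀(L⁻¹s - ε)` for `J_c`.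
  · exact existsUnique_isGradientOn he' (fun h _ t => strainEnergy_expansion L ε e h t)
      fun h _ => inner_toStrain (stressOf L e) h
  · exact existsUnique_isGradientOn hs (fun h _ t => complEnergy_expansion L ε s h t)
      fun h _ => inner_toStress (strainOf L s - uniform Q L₀ ε) h
  · rw [geomFunctional, compatError_eq_zero he', equilError_eq_zero hs]
    ring
  · rw [geomFunctional, compatError_eq_zero he', equilError_stressOf hJ, meanConstError_eq,
      strainOf_stressOf]
    ring
  · rw [geomFunctional, compatError_strainOf hJc, equilError_eq_zero hs, meanConstError_eq,
      stressOf_strainOf]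
    ring
  · rw [geomFunctional, compatError_strainOf hJc, equilError_stressOf hJ, meanConstError_eq,
      meanConstError_eq, strainOf_stressOf, stressOf_strainOf, hcross]
    ring
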